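/- **Setting.** Let $x=\{x_1,\dots,x_N\}$ be a data set partitioned into $S$ non-empty shards $\mathbf x_1,\dots,\mathbf x_S$ of sizes $N_1,\dots,N_S$, $N=\sum_s N_s$. Let $p(\theta)>0$ be a prior on $\mathbb R^d$ and $p(x_i\mid\theta)>0$ the likelihoods, all $C^3$ in $\theta$, with $p(\theta)\prod_i p(x_i\mid\theta)$ integrable, and let $p(\theta\mid x)\propto p(\theta)\prod_i p(x_i\mid\theta)$ be the posterior density. Let $f_s>0$, $\sum_s f_s=1$, $m\ge 1$. DSGLD with constant step size $h>0$ is the chain $$\theta_{t+1}=\theta_t+\tfrac h2\Big(\nabla\log p(\theta_t)+\tfrac{N_{s_t}}{f_{s_t}m}\sum_{y\in \mathbf x_{s_t}^{(m)}}\nabla\log p(y\mid\theta_t)\Big)+\eta_t,\qquad \eta_t\sim\mathcal N(0,hI),$$ where at each step $s_t$ is drawn with probabilities $f_1,\dots,f_S$, then a mini-batch $\mathbf x_{s_t}^{(m)}$ of $m$ points is drawn uniformly with replacement from shard $s_t$, and $\theta_0$, the draws and the Gaussian noises of all steps are independent. For a test function $\phi$ put $\hat\phi=T^{-1}\sum_{t=1}^T\phi(\theta_t)$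 and $\bar\phi=\int\phi(\theta)\,p(\theta\mid x)\,d\theta$ (assumed to converge absolutely). **Assumptions.** (a) $\|\nabla\log p(x_i\mid\theta)\|\le\gamma_s$ for all $\theta$, all $s$ and all $x_i\in\mathbf x_s$. (b) $\phi$ is $C^2$, and $\psi\in C^3$ solves the Poisson equation $\mathcal L\psi=\phi-\bar\phi$, where $\mathcal L\psi=\tfrac12\nabla\log p(\theta\mid x)\cdot\nabla\psi+\tfrac12\Delta\psi$. There are a measurable function $\Gamma\ge 0$, exponents $p_0,\dots,p_3,r,q>0$ and constants $C_k, C', C''_k$ with $\|D^k\psi\|\le C_k\Gamma^{p_k}$ ($0\le k\le 3$), $\|D^2\phi\|\le C'(1+\Gamma^{r})$ and $\|D^k\log p(\cdot\mid x)\|\le C''_k(1+\Gamma^{q})$ ($1\le k\le3$). (c) Let $R=2\max(p_0,p_1,p_2,p_3,r)+6q$. For each $0<\rho\le R$ there is a constant $c_\rho$ with $\Gamma^\rho(a\theta+(1-a)\theta')\le c_\rho(\Gamma^\rho(\theta)+\Gamma^\rho(\theta'))$ for all $\theta,\theta'$ and $a\in(0,1)$. (d) $H\subseteq(0,\infty)$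 is a set of step sizes such that $\sup_{h\in H}\sup_{t\ge0}\mathbb E\,\Gamma^\rho(\theta_t)<\infty$ for each $0<\rho\le R$. **Conclusion.** There is a constant $C>0$, independent of $T$ and $h$, such that for all $h\in H$ and all $T\ge1$ the mean squared error is finite and $$\mathbb E(\hat\phi-\bar\phi)^2\le C\left(\frac{\sum_s \frac{N_s^2}{f_s}\gamma_s^2}{mT}+\frac1{hT}+h^2\right).$$ Moreover, if all shards are merged into one data set and the chain is SGLD, i.e. the gradient estimator is $\nabla\log p(\theta)+\frac Nm\sum_{y\in\mathbf x^{(m)}}\nabla\log p(y\mid\theta)$ with $m$ points drawn uniformly with replacement from the whole data set, if (d) holds for this chain, and if $\gamma\ge\gamma_1,\dots,\gamma_S$, then for some $C>0$ independent of $T$ and $h$, for all $h\in H$ and $T\ge1$, $$\mathbb E(\hat\phi-\bar\phi)^2\le C\left(\frac{N^2\gamma^2}{mT}+\frac1{hT}+h^2\right).$$ -/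

import Mathlib

open MeasureTheory ProbabilityTheory
open scoped Gradient

noncomputable section

namespace DSGLD

/-- The parameter space `ℝᵈ` with its Euclidean norm. -/
abbrev Param (d : ℕ) : Type := EuclideanSpace ℝ (Fin d)

/-- A Bayesian model together with a data set that is split into `S` shards: shard `s` holds the
`N s` data points `x s 0, …, x s (N s - 1)`. `prior θ` is the prior density `p(θ)` and `lik y θ` is
the likelihood `p(y | θ)` of a single datum `y`. -/
structure Model (d S : ℕ) (𝒳 : Type*) where
  prior : Param d → ℝ
  lik : 𝒳 → Param d → ℝ
  N : Fin S → ℕ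
  x : (s : Fin S) → Fin (N s) → 𝒳

variable {d S : ℕ} {𝒳 : Type*}

namespace Model

/-- The total number of data points. -/
def total (M : Model d S 𝒳) : ℕ := ∑ s, M.N s

/-- `p(θ) ∏ᵢ p(xᵢ | θ)`. -/
def unnormalized (M : Model d S 𝒳) (θ : Param d) : ℝ :=
  M.prior θ * ∏ s, ∏ i, M.lik (M.x s i) θ

/-- The posterior density `p(θ | x)`. -/
def posterior (M : Model d S 𝒳) (θ : Param d) : ℝ :=
  M.unnormalized θ / ∫ θ', M.unnormalized θ'

/-- The posterior expectation of `φ`. -/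
def posteriorMean (M : Model d S 𝒳) (φ : Param d → ℝ) : ℝ :=
  ∫ θ, φ θ * M.posterior θ

/-- The posterior is a well-defined density with a three times continuously differentiable
logarithm: the prior and the likelihood of every datum are positive and `C³`, the posterior is
proper, and no shard is empty. -/
structure IsRegular (M : Model d S 𝒳) : Prop where
  shard_nonempty : ∀ s, 0 < M.N s
  prior_pos : ∀ θ, 0 < M.prior θ
  lik_pos : ∀ s i θ, 0 < M.lik (M.x s i) θ
  prior_contDiff : ContDiff ℝ 3 M.prior
  lik_contDiff : ∀ s i, ContDiff ℝ 3 (M.lik (M.x s i))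
  proper : Integrable M.unnormalized

/-- The generator `ℒψ = ½ ∇ log p(θ | x) · ∇ψ + ½ Δψ` of the Langevin diffusion
`dθ = ½ ∇ log p(θ | x) dt + dW`. -/
def generator (M : Model d S 𝒳) (ψ : Param d → ℝ) (θ : Param d) : ℝ :=
  (1 / 2) * inner ℝ (∇ (fun θ' => Real.log (M.posterior θ')) θ) (∇ ψ θ)
    + (1 / 2) * Laplacian.laplacian ψ θ

/-- The gradient `∇ log p(y | θ)` of the log-likelihood of one datum. -/
def gradLogLik (M : Model d S 𝒳) (y : 𝒳) (θ : Param d) : Param d :=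
  ∇ (fun θ' => Real.log (M.lik y θ')) θ

/-- A choice of a shard together with `m` indices of data points in that shard. -/
abbrev ShardBatch (M : Model d S 𝒳) (m : ℕ) : Type := (s : Fin S) × (Fin m → Fin (M.N s))

/-- The probability of a shard and a mini-batch: the shard is drawn with probability `f s`, then the
`m` data points are drawn uniformly and with replacement from that shard. -/
def shardBatchProb (M : Model d S 𝒳) (f : Fin S → ℝ) (m : ℕ) (b : M.ShardBatch m) : ℝ :=
  f b.1 * (1 / (M.N b.1 : ℝ)) ^ m

/-- The DSGLD gradient estimator
`v_s(θ) = ∇ log p(θ) + N_s / (f_s m) ∑_{y in the mini-batch} ∇ log p(y | θ)`. -/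
def dsgldEstimator (M : Model d S 𝒳) (f : Fin S → ℝ) (m : ℕ) (b : M.ShardBatch m)
    (θ : Param d) : Param d :=
  ∇ (fun θ' => Real.log (M.prior θ')) θ
    + ((M.N b.1 : ℝ) / (f b.1 * m)) • ∑ j, M.gradLogLik (M.x b.1 (b.2 j)) θ

/-- `m` indices of data points in the merged data set. -/
abbrev MergedBatch (M : Model d S 𝒳) (m : ℕ) : Type := Fin m → (s : Fin S) × Fin (M.N s)

/-- The probability of a mini-batch drawn uniformly and with replacement from the merged data. -/
def mergedBatchProb (M : Model d S 𝒳) (m : ℕ) (_b : M.MergedBatch m) : ℝ :=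
  (1 / (M.total : ℝ)) ^ m

/-- The SGLD gradient estimator on the merged data,
`v(θ) = ∇ log p(θ) + N / m ∑_{y in the mini-batch} ∇ log p(y | θ)`. -/
def sgldEstimator (M : Model d S 𝒳) (m : ℕ) (b : M.MergedBatch m) (θ : Param d) : Param d :=
  ∇ (fun θ' => Real.log (M.prior θ')) θ
    + ((M.total : ℝ) / m) • ∑ j, M.gradLogLik (M.x (b j).1 (b j).2) θ

end Model

section Chain

variable {β : Type*} {Ω : Type*}

/-- The recursion `θ_{t+1} = θ_t + (h / 2) v_t(θ_t) + η_t` with constant step size `h`, where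
`v_t = v (B t)` is the gradient estimator of the random mini-batch `B t` and `η_t = √h Z_t`, so that
`η_t ∼ 𝒩(0, h I)` if `Z_t` is standard Gaussian. -/
def chain (v : β → Param d → Param d) (θ₀ : Ω → Param d) (B : ℕ → Ω → β)
    (Z : ℕ → Ω → Param d) (h : ℝ) : ℕ → Ω → Param d
  | 0, ω => θ₀ ω
  | t + 1, ω =>
      chain v θ₀ B Z h t ω + (h / 2) • v (B t ω) (chain v θ₀ B Z h t ω) + √h • Z t ω

/-- The sample average `T⁻¹ ∑_{t=1}^T φ(θ_t)`. -/
def sampleAverage (φ : Param d → ℝ) (θ : ℕ → Ω → Param d) (T : ℕ) (ω : Ω) : ℝ :=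
  (T : ℝ)⁻¹ * ∑ t ∈ Finset.Icc 1 T, φ (θ t ω)

/-- The randomness that drives the chain: an initial state, mini-batches `B t` with the
probabilities `w`, and standard Gaussian vectors `Z t`, all mutually independent. -/
structure IsDrivingNoise [MeasurableSpace β] [MeasurableSpace Ω] (P : Measure Ω) (w : β → ℝ)
    (θ₀ : Ω → Param d) (B : ℕ → Ω → β) (Z : ℕ → Ω → Param d) : Prop where
  measurable_init : Measurable θ₀
  measurable_batch : ∀ t, Measurable (B t)
  measurable_noise : ∀ t, Measurable (Z t)
  batch_law : ∀ t b, P.real (B t ⁻¹' {b}) = w b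
  noise_law : ∀ t, P.map (Z t) = stdGaussian (Param d)
  indep_batch_noise : ∀ t, IndepFun (B t) (Z t) P
  indep_time : iIndepFun (fun t ω => (B t ω, Z t ω)) P
  indep_init : IndepFun θ₀ (fun ω t => (B t ω, Z t ω)) P

/-- The moments of `Γ` of all orders `0 < ρ ≤ R` are bounded along the chain, uniformly in time and
in the step size `h ∈ H`. -/
def MomentsBounded [MeasurableSpace Ω] (P : Measure Ω) (Γ : Param d → ℝ) (R : ℝ) (H : Set ℝ)
    (θ : ℝ → ℕ → Ω → Param d) : Prop :=
  ∀ ρ : ℝ, 0 < ρ → ρ ≤ R → ∃ K : ℝ, ∀ h ∈ H, ∀ t : ℕ,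
    Integrable (fun ω => Γ (θ h t ω) ^ ρ) P ∧ ∫ ω, Γ (θ h t ω) ^ ρ ∂P ≤ K

end Chain

/-- The order up to which powers of the dominating function are controlled:
`2 max(p₀, p₁, p₂, p₃, r) + 6 q`. -/
def momentOrder (p : Fin 4 → ℝ) (r q : ℝ) : ℝ := 2 * max (⨆ k, p k) r + 6 * q

/-- The regularity conditions on the test function `φ` and the solution `ψ` of the Poisson equation
`ℒψ = φ - φ̄`: the derivatives of `ψ` up to order three, the second derivative of `φ`, and the
derivatives of the log-posterior of orders one to three are dominated by powers of `Γ`, and the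
powers of `Γ` are controlled along segments. -/
structure PoissonRegularity (M : Model d S 𝒳) (φ ψ Γ : Param d → ℝ) (p : Fin 4 → ℝ) (r q : ℝ) :
    Prop where
  test_contDiff : ContDiff ℝ 2 φ
  test_integrable : Integrable (fun θ => φ θ * M.posterior θ)
  sol_contDiff : ContDiff ℝ 3 ψ
  poisson : ∀ θ, M.generator ψ θ = φ θ - M.posteriorMean φ
  dom_measurable : Measurable Γ
  dom_nonneg : ∀ θ, 0 ≤ Γ θ
  p_pos : ∀ k, 0 < p k
  r_pos : 0 < r
  q_pos : 0 < q
  sol_growth : ∀ k : Fin 4, ∃ C : ℝ, ∀ θ, ‖iteratedFDeriv ℝ k ψ θ‖ ≤ C * Γ θ ^ p k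
  test_growth : ∃ C : ℝ, ∀ θ, ‖iteratedFDeriv ℝ 2 φ θ‖ ≤ C * (1 + Γ θ ^ r)
  logPosterior_growth : ∀ k : ℕ, 1 ≤ k → k ≤ 3 → ∃ C : ℝ, ∀ θ,
    ‖iteratedFDeriv ℝ k (fun θ' => Real.log (M.posterior θ')) θ‖ ≤ C * (1 + Γ θ ^ q)
  dom_segment : ∀ ρ : ℝ, 0 < ρ → ρ ≤ momentOrder p r q → ∃ C : ℝ, ∀ θ θ' : Param d,
    ∀ a ∈ Set.Ioo (0 : ℝ) 1, Γ (a • θ + (1 - a) • θ') ^ ρ ≤ C * (Γ θ ^ ρ + Γ θ' ^ ρ)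

end DSGLD

end

/-!
Let `F = ∇ log p(· | x)`. The estimators are unbiased, so `E ψ(θ_{t+1}) - ψ(θ_t)`, given `θ_t`,
is `h ℒψ(θ_t) = h (φ(θ_t) - φ̄)` up to an error of order `h²` for `h ≤ 1`. Summing over `t`, the
`ψ`-differences telescope, the centred increments are orthogonal with `L²` norms of order `√h`,
and the `L²` norms of the biases add up to order `T h²`. Dividing by `T h` yields
`1 / (h T) + h²`. For `h ≥ 1` the second moments of `φ(θ_t) - φ̄`, bounded uniformly in `t` and
`h`, suffice. The mini-batches contribute only `O(1 / T)` to the squared error, which `1 / (h T)`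
absorbs when `h ≤ 1`.

As `ψ` is only `C³`, the Gaussian part of a step is not expanded by a fourth-order Taylor
formula: Stein's identity gives `d/ds E ψ(y + s Z) = s E Δψ(y + s Z)`, and two derivatives of
`Δψ` are at hand because the Poisson equation expresses it as `2 (φ - φ̄) - F · ∇ψ`.

The moments of the weight `W` bounding all derivatives are controlled only at the states of the
chain, not at `y = θ_t + (h / 2) v(θ_t)`. Since `y` is the midpoint of `y + √h Z` and `y - √h Z`,
which have the same law, the segment condition carries the control over to `y`.
-/

noncomputable section

namespace DSGLD

open scoped Laplacian

section Gaussian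

variable {E : Type*} [NormedAddCommGroup E] [InnerProductSpace ℝ E] [FiniteDimensional ℝ E]
  [MeasurableSpace E] [BorelSpace E]

theorem integrable_exp_neg_half_sq_norm :
    Integrable (fun z : E => Real.exp (-(1 / 2) * ‖z‖ ^ 2)) := by
  have h := GaussianFourier.integrable_cexp_neg_mul_sq_norm_add (V := E) (b := 1 / 2)
    (by norm_num) 0 0
  refine h.norm.congr (ae_of_all _ fun z => ?_)
  simp [Complex.norm_exp, ← Complex.ofReal_pow]

theorem integral_exp_neg_half_sq_norm_pos :
    0 < ∫ z : E, Real.exp (-(1 / 2) * ‖z‖ ^ 2) :=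
  integral_exp_pos integrable_exp_neg_half_sq_norm

variable (E) in
/-- The density of the standard Gaussian measure with respect to the volume. -/
def gaussianDensity (z : E) : ℝ :=
  (∫ z : E, Real.exp (-(1 / 2) * ‖z‖ ^ 2))⁻¹ * Real.exp (-(1 / 2) * ‖z‖ ^ 2)

theorem gaussianDensity_nonneg (z : E) : 0 ≤ gaussianDensity E z :=
  mul_nonneg (inv_nonneg.2 integral_exp_neg_half_sq_norm_pos.le) (Real.exp_nonneg _)

theorem continuous_gaussianDensity : Continuous (gaussianDensity E) := by
  unfold gaussianDensity; fun_prop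

theorem hasFDerivAt_gaussianDensity (z : E) :
    HasFDerivAt (gaussianDensity E) (-(gaussianDensity E z) • innerSL ℝ z) z := by
  have h_exponent : HasFDerivAt (fun z : E => -(1 / 2 : ℝ) * ‖z‖ ^ 2)
      (-(1 / 2 : ℝ) • (2 • innerSL ℝ z)) z :=
    (hasStrictFDerivAt_norm_sq z).hasFDerivAt.const_mul _
  refine (h_exponent.exp.const_mul _).congr_fderiv ?_
  ext w
  simp only [gaussianDensity, smul_apply, innerSL_apply_apply, smul_eq_mul, nsmul_eq_mul]
  ring

variable (E) in
theorem stdGaussian_eq_withDensity :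
    stdGaussian E = volume.withDensity fun z => ENNReal.ofReal (gaussianDensity E z) := by
  have hintg : Integrable (gaussianDensity E) := integrable_exp_neg_half_sq_norm.const_mul _
  have : IsFiniteMeasure ((volume : Measure E).withDensity
      fun z => ENNReal.ofReal (gaussianDensity E z)) :=
    isFiniteMeasure_withDensity_ofReal hintg.2
  refine Measure.ext_of_charFun (funext fun t => ?_)
  rw [charFun_stdGaussian, charFun_apply, integral_withDensity_eq_integral_toReal_smul
    continuous_gaussianDensity.measurable.ennreal_ofReal (by simp)]
  have hZ : ((∫ z : E, Real.exp (-(1 / 2) * ‖z‖ ^ 2) : ℝ) : ℂ)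
      = (Real.pi / (1 / 2) : ℂ) ^ (Module.finrank ℝ E / 2 : ℂ) := by
    rw [← integral_complex_ofReal]
    simpa using GaussianFourier.integral_cexp_neg_mul_sq_norm_add (V := E) (b := 1 / 2)
      (by norm_num) 0 0
  have hZ_ne : ((∫ z : E, Real.exp (-(1 / 2) * ‖z‖ ^ 2) : ℝ) : ℂ) ≠ 0 := by
    exact_mod_cast integral_exp_neg_half_sq_norm_pos.ne'
  have h_fourier := GaussianFourier.integral_cexp_neg_mul_sq_norm_add (V := E) (b := 1 / 2)
    (by norm_num) Complex.I t
  rw [← hZ] at h_fourier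
  have h_integrand : ∀ z : E, (ENNReal.ofReal (gaussianDensity E z)).toReal
      • Complex.exp (inner ℝ z t * Complex.I)
      = ((∫ z : E, Real.exp (-(1 / 2) * ‖z‖ ^ 2) : ℝ) : ℂ)⁻¹
        * Complex.exp (-(1 / 2) * ‖z‖ ^ 2 + Complex.I * inner ℝ t z) := by
    intro z
    rw [ENNReal.toReal_ofReal (gaussianDensity_nonneg z), gaussianDensity, Complex.exp_add,
      Complex.real_smul, real_inner_comm]
    push_cast
    ring_nf
  simp_rw [h_integrand]
  rw [integral_const_mul, h_fourier, inv_mul_cancel_left₀ hZ_ne, Complex.I_sq]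
  ring_nf

theorem integrable_stdGaussian_iff {f : E → ℝ} :
    Integrable f (stdGaussian E) ↔ Integrable fun z => gaussianDensity E z * f z := by
  rw [stdGaussian_eq_withDensity E, integrable_withDensity_iff_integrable_smul'
    continuous_gaussianDensity.measurable.ennreal_ofReal (by simp)]
  simp [ENNReal.toReal_ofReal (gaussianDensity_nonneg _)]

theorem integral_stdGaussian_eq (f : E → ℝ) :
    ∫ z, f z ∂(stdGaussian E) = ∫ z, gaussianDensity E z * f z := by
  rw [stdGaussian_eq_withDensity E, integral_withDensity_eq_integral_toReal_smul
    continuous_gaussianDensity.measurable.ennreal_ofReal (by simp)]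
  simp [ENNReal.toReal_ofReal (gaussianDensity_nonneg _)]

theorem integral_mul_inner_stdGaussian {f : E → ℝ} (hf : Differentiable ℝ f) (e : E)
    (hintg : Integrable f (stdGaussian E))
    (hintg_inner : Integrable (fun z => f z * inner ℝ e z) (stdGaussian E))
    (hintg_deriv : Integrable (fun z => fderiv ℝ f z e) (stdGaussian E)) :
    ∫ z, f z * inner ℝ e z ∂(stdGaussian E) = ∫ z, fderiv ℝ f z e ∂(stdGaussian E) := by
  rw [integrable_stdGaussian_iff] at hintg hintg_inner hintg_deriv
  have hd : ∀ z : E, fderiv ℝ (gaussianDensity E) z e = -(gaussianDensity E z * inner ℝ e z) := by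
    intro z
    rw [(hasFDerivAt_gaussianDensity z).fderiv]
    simp [real_inner_comm]
  have h_parts := integral_mul_fderiv_eq_neg_fderiv_mul_of_integrable (μ := (volume : Measure E))
    (f := gaussianDensity E) (g := f) (v := e)
    (by
      simp_rw [hd]
      refine hintg_inner.neg.congr (ae_of_all _ fun z => ?_)
      simp only [Pi.neg_apply]
      ring)
    hintg_deriv hintg (fun z _ => (hasFDerivAt_gaussianDensity z).differentiableAt)
    (fun z _ => hf z)
  rw [integral_stdGaussian_eq, integral_stdGaussian_eq, h_parts, ← integral_neg]
  simp_rw [hd]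
  congr 1 with z
  ring

theorem memLp_norm_rpow_stdGaussian {k : ℝ} (hk : 0 < k) (p : NNReal) :
    MemLp (fun z : E => ‖z‖ ^ k) p (stdGaussian E) := by
  lift k to NNReal using hk.le
  have hk' : (k : ENNReal) ≠ 0 := by exact_mod_cast hk.ne'
  have h := (IsGaussian.memLp_id (stdGaussian E) (k * p) (by finiteness)).norm_rpow_div k
  rwa [ENNReal.mul_div_right_comm, ENNReal.div_self hk' (by finiteness), one_mul] at h

theorem map_neg_stdGaussian : (stdGaussian E).map (fun z => -z) = stdGaussian E :=
  stdGaussian_map (LinearIsometryEquiv.neg ℝ (E := E))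

end Gaussian

section Taylor

variable {E : Type*} [NormedAddCommGroup E] [NormedSpace ℝ E]
  {F : Type*} [NormedAddCommGroup F] [NormedSpace ℝ F]

theorem norm_image_add_sub_le {f : E → F} (hf : Differentiable ℝ f) {x u : E} {G : ℝ}
    (hG : ∀ c ∈ Set.Icc (0 : ℝ) 1, ‖fderiv ℝ f (x + c • u)‖ ≤ G) :
    ‖f (x + u) - f x‖ ≤ G * ‖u‖ := by
  have h := (convex_segment (𝕜 := ℝ) x (x + u)).norm_image_sub_le_of_norm_fderiv_le (f := f)
    (C := G) (fun w _ => hf w) (fun w hw => by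
      rw [segment_eq_image'] at hw
      obtain ⟨c, hc, rfl⟩ := hw
      simpa using hG c hc) (left_mem_segment ℝ _ _) (right_mem_segment ℝ _ _)
  simpa using h

theorem norm_image_add_sub_sub_fderiv_le {f : E → F} (hf : ContDiff ℝ 2 f) {x u : E} {G : ℝ}
    (hG : ∀ c ∈ Set.Icc (0 : ℝ) 1, ‖fderiv ℝ (fderiv ℝ f) (x + c • u)‖ ≤ G) :
    ‖f (x + u) - f x - fderiv ℝ f x u‖ ≤ G * ‖u‖ ^ 2 := by
  have hd : Differentiable ℝ f := hf.differentiable (by norm_num)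
  have hd' : Differentiable ℝ (fderiv ℝ f) :=
    (hf.fderiv_right (m := 1) (by norm_num)).differentiable (by norm_num)
  have hG0 : 0 ≤ G :=
    (norm_nonneg (fderiv ℝ (fderiv ℝ f) (x + (0 : ℝ) • u))).trans (hG 0 (by simp))
  have h_deriv : ∀ c ∈ Set.Icc (0 : ℝ) 1, ‖fderiv ℝ f (x + c • u) - fderiv ℝ f x‖ ≤ G * ‖u‖ := by
    intro c hc
    refine (norm_image_add_sub_le hd' (x := x) (u := c • u) (G := G) fun c' hc' => ?_).trans ?_
    · rw [smul_smul]
      exact hG _ ⟨mul_nonneg hc'.1 hc.1, mul_le_one₀ hc'.2 hc.1 hc.2⟩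
    · rw [norm_smul, Real.norm_of_nonneg hc.1]
      exact mul_le_mul_of_nonneg_left (mul_le_of_le_one_left (norm_nonneg _) hc.2) hG0
  have h_sub_linear := norm_image_add_sub_le (f := fun w => f w - fderiv ℝ f x w) (x := x) (u := u)
    (G := G * ‖u‖) (hd.sub (fderiv ℝ f x).differentiable) (fun c hc => by
      rw [fderiv_fun_sub (hd _) (fderiv ℝ f x).differentiableAt, ContinuousLinearMap.fderiv]
      exact h_deriv c hc)
  calc ‖f (x + u) - f x - fderiv ℝ f x u‖
      = ‖f (x + u) - fderiv ℝ f x (x + u) - (f x - fderiv ℝ f x x)‖ := by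
        rw [map_add]; congr 1; abel
    _ ≤ G * ‖u‖ ^ 2 := h_sub_linear.trans_eq (by ring)

end Taylor

section Heat

theorem abs_intervalIntegral_mul_sub_le {g : ℝ → ℝ} {a σ K : ℝ} (hg : StronglyMeasurable g)
    (hσ : 0 ≤ σ) (h : ∀ s ∈ Set.Icc 0 σ, |g s - a| ≤ s ^ 2 * K) :
    |(∫ s in (0 : ℝ)..σ, s * g s) - σ ^ 2 / 2 * a| ≤ σ ^ 4 / 4 * K := by
  have h_bound : ∀ s ∈ Set.Ioc 0 σ, ‖s * (g s - a)‖ ≤ s ^ 3 * K := by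
    intro s hs
    rw [norm_mul, Real.norm_of_nonneg hs.1.le, pow_succ', mul_assoc]
    exact mul_le_mul_of_nonneg_left (h s ⟨hs.1.le, hs.2⟩) hs.1.le
  have h_cubic : IntervalIntegrable (fun s => s ^ 3 * K) volume 0 σ :=
    Continuous.intervalIntegrable (by fun_prop) _ _
  have h_diff : IntervalIntegrable (fun s => s * (g s - a)) volume 0 σ :=
    h_cubic.mono_fun' (by fun_prop) (by
      rw [Set.uIoc_of_le hσ]
      exact ae_restrict_of_forall_mem measurableSet_Ioc h_bound)
  have h_split : (∫ s in (0 : ℝ)..σ, s * g s) - σ ^ 2 / 2 * a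
      = ∫ s in (0 : ℝ)..σ, s * (g s - a) := by
    have h_eq : ∀ s, s * g s = s * (g s - a) + s * a := fun s => by ring
    simp_rw [h_eq]
    rw [intervalIntegral.integral_add h_diff (Continuous.intervalIntegrable (by fun_prop) _ _),
      intervalIntegral.integral_mul_const, integral_id]
    ring
  rw [h_split, ← Real.norm_eq_abs]
  refine (intervalIntegral.norm_integral_le_of_norm_le hσ (ae_of_all _ h_bound)
    h_cubic).trans_eq ?_
  rw [intervalIntegral.integral_mul_const, integral_pow]
  norm_num

theorem integrable_norm_mul {E : Type*} [NormedAddCommGroup E] [MeasurableSpace E]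
    [OpensMeasurableSpace E] {μ : Measure E} {G : E → ℝ} (hG : Integrable G μ)
    (hG2 : Integrable (fun z => ‖z‖ ^ 2 * G z) μ) : Integrable (fun z => ‖z‖ * G z) μ := by
  refine (hG.norm.add hG2.norm).mono' (measurable_norm.aestronglyMeasurable.mul hG.1)
    (ae_of_all _ fun z => ?_)
  simp only [Pi.add_apply, norm_mul, norm_norm, norm_pow]
  nlinarith [mul_nonneg (norm_nonneg (G z)) (sq_nonneg (‖z‖ - 1)),
    mul_nonneg (norm_nonneg (G z)) (sq_nonneg ‖z‖)]

variable {E : Type*} [NormedAddCommGroup E] [InnerProductSpace ℝ E] [FiniteDimensional ℝ E]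

theorem laplacian_eq_sum_fderiv_fderiv {ι : Type*} [Fintype ι] (b : OrthonormalBasis ι ℝ E)
    (ψ : E → ℝ) (u : E) : Δ ψ u = ∑ i, fderiv ℝ (fderiv ℝ ψ) u (b i) (b i) := by
  rw [congrFun (InnerProductSpace.laplacian_eq_iteratedFDeriv_orthonormalBasis ψ b) u]
  simp [iteratedFDeriv_two_apply]

variable [MeasurableSpace E] [BorelSpace E]

variable {y : E} {s σ : ℝ} {G : E → ℝ}

theorem integral_comp_add_smul_mul_inner_stdGaussian {f : E → ℝ} (hf : ContDiff ℝ 1 f) {e : E}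
    (he : ‖e‖ = 1) (hG : Integrable G (stdGaussian E))
    (hG1 : Integrable (fun z => ‖z‖ * G z) (stdGaussian E))
    (h0 : ∀ z, ‖f (y + s • z)‖ ≤ G z) (h1 : ∀ z, ‖fderiv ℝ f (y + s • z) e‖ ≤ G z) :
    Integrable (fun z => f (y + s • z) * inner ℝ e z) (stdGaussian E) ∧
    Integrable (fun z => fderiv ℝ f (y + s • z) e) (stdGaussian E) ∧
    ∫ z, f (y + s • z) * inner ℝ e z ∂(stdGaussian E)
      = s * ∫ z, fderiv ℝ f (y + s • z) e ∂(stdGaussian E) := by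
  have hfc : Continuous f := hf.continuous
  have : Continuous (fderiv ℝ f) := hf.continuous_fderiv (by norm_num)
  have hd : ∀ z, HasFDerivAt (fun z => f (y + s • z)) (s • fderiv ℝ f (y + s • z)) z := by
    intro z
    refine ((hf.differentiable (by norm_num) (y + s • z)).hasFDerivAt.comp z
      (((hasFDerivAt_id z).const_smul s).const_add y)).congr_fderiv ?_
    ext w
    simp
  have hintg : Integrable (fun z => f (y + s • z)) (stdGaussian E) :=
    hG.mono' (by fun_prop) (ae_of_all _ h0)
  have hintg_inner : Integrable (fun z => f (y + s • z) * inner ℝ e z) (stdGaussian E) := by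
    refine hG1.mono' (by fun_prop) (ae_of_all _ fun z => ?_)
    rw [norm_mul, mul_comm]
    exact mul_le_mul ((norm_inner_le_norm _ _).trans (by simp [he])) (h0 z) (norm_nonneg _)
      (norm_nonneg _)
  have hintg_deriv : Integrable (fun z => fderiv ℝ f (y + s • z) e) (stdGaussian E) :=
    hG.mono' (by fun_prop) (ae_of_all _ h1)
  refine ⟨hintg_inner, hintg_deriv, ?_⟩
  have hd_apply : ∀ z, fderiv ℝ (fun z => f (y + s • z)) z e = s * fderiv ℝ f (y + s • z) e :=
    fun z => by rw [(hd z).fderiv]; rfl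
  rw [← integral_const_mul, integral_mul_inner_stdGaussian (fun z => (hd z).differentiableAt) e
    hintg hintg_inner (by simpa only [hd_apply] using hintg_deriv.const_mul s)]
  simp_rw [hd_apply]

theorem integral_fderiv_add_smul_stdGaussian {ψ : E → ℝ} (hψ : ContDiff ℝ 2 ψ)
    (hG : Integrable G (stdGaussian E)) (hG1 : Integrable (fun z => ‖z‖ * G z) (stdGaussian E))
    (h1 : ∀ z, ‖fderiv ℝ ψ (y + s • z)‖ ≤ G z)
    (h2 : ∀ z, ‖fderiv ℝ (fderiv ℝ ψ) (y + s • z)‖ ≤ G z) :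
    ∫ z, fderiv ℝ ψ (y + s • z) z ∂(stdGaussian E)
      = s * ∫ z, Δ ψ (y + s • z) ∂(stdGaussian E) := by
  let b := stdOrthonormalBasis ℝ E
  have hd : ContDiff ℝ 1 (fderiv ℝ ψ) := hψ.fderiv_right (by norm_num)
  have hd_apply : ∀ i u, fderiv ℝ (fun u => fderiv ℝ ψ u (b i)) u (b i)
      = fderiv ℝ (fderiv ℝ ψ) u (b i) (b i) := fun i u => by
    simp [fderiv_clm_apply (hd.differentiable (by norm_num) u) (differentiableAt_const (b i))]
  have h_stein := fun i =>
    integral_comp_add_smul_mul_inner_stdGaussian (f := fun u => fderiv ℝ ψ u (b i)) (e := b i)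
      (y := y) (s := s) (hd.clm_apply contDiff_const) (b.norm_eq_one i) hG hG1
      (fun z => ((fderiv ℝ ψ (y + s • z)).le_opNorm _).trans (by simpa using h1 z))
      (fun z => by
        rw [hd_apply]
        exact (ContinuousLinearMap.le_opNorm₂ _ _ _).trans (by simpa using h2 z))
  simp only [hd_apply] at h_stein
  have h_expand : ∀ z, fderiv ℝ ψ (y + s • z) z
      = ∑ i, fderiv ℝ ψ (y + s • z) (b i) * inner ℝ (b i) z := by
    intro z
    have h := congrArg (fderiv ℝ ψ (y + s • z)) (b.sum_repr' z)
    rw [map_sum] at h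
    rw [← h]
    exact Finset.sum_congr rfl fun i _ => by rw [map_smul, smul_eq_mul, mul_comm]
  simp_rw [h_expand, laplacian_eq_sum_fderiv_fderiv b]
  rw [integral_finsetSum _ fun i _ => (h_stein i).1,
    integral_finsetSum _ fun i _ => (h_stein i).2.1, Finset.mul_sum]
  exact Finset.sum_congr rfl fun i _ => (h_stein i).2.2

theorem integrable_comp_add_smul {μ : Measure E} [IsFiniteMeasure μ] {ψ : E → ℝ}
    (hψ : Differentiable ℝ ψ) (hσ : 0 ≤ σ) (hG1 : Integrable (fun z => ‖z‖ * G z) μ)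
    (h1 : ∀ z, ∀ s ∈ Set.Icc 0 σ, ‖fderiv ℝ ψ (y + s • z)‖ ≤ G z) :
    Integrable (fun z => ψ (y + σ • z)) μ := by
  have hψc : Continuous ψ := hψ.continuous
  refine ((integrable_const |ψ y|).add (hG1.const_mul σ)).mono' (by fun_prop)
    (ae_of_all _ fun z => ?_)
  have h_diff : ‖ψ (y + σ • z) - ψ y‖ ≤ G z * ‖σ • z‖ :=
    norm_image_add_sub_le hψ fun c hc => by
      rw [smul_smul]
      exact h1 z _ ⟨mul_nonneg hc.1 hσ, mul_le_of_le_one_left hσ hc.2⟩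
  rw [norm_smul, Real.norm_of_nonneg hσ] at h_diff
  simp only [Pi.add_apply, Real.norm_eq_abs] at h_diff ⊢
  linarith [abs_sub_abs_le_abs_sub (ψ (y + σ • z)) (ψ y)]

theorem integral_comp_add_smul_sub_eq_intervalIntegral {μ : Measure E} [IsProbabilityMeasure μ]
    {ψ : E → ℝ} (hψ : ContDiff ℝ 1 ψ) (hσ : 0 ≤ σ) (hG1 : Integrable (fun z => ‖z‖ * G z) μ)
    (h1 : ∀ z, ∀ s ∈ Set.Icc 0 σ, ‖fderiv ℝ ψ (y + s • z)‖ ≤ G z) :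
    ∫ z, ψ (y + σ • z) ∂μ - ψ y = ∫ s in (0 : ℝ)..σ, ∫ z, fderiv ℝ ψ (y + s • z) z ∂μ := by
  have hd : Differentiable ℝ ψ := hψ.differentiable (by norm_num)
  have : Continuous (fderiv ℝ ψ) := hψ.continuous_fderiv (by norm_num)
  have h_line : ∀ z s, HasDerivAt (fun s : ℝ => ψ (y + s • z)) (fderiv ℝ ψ (y + s • z) z) s :=
    fun z s => (hd (y + s • z)).hasFDerivAt.comp_hasDerivAt s
      (by simpa using ((hasDerivAt_id s).smul_const z).const_add y)
  have h_ftc : ∀ z, ψ (y + σ • z) - ψ y = ∫ s in (0 : ℝ)..σ, fderiv ℝ ψ (y + s • z) z := by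
    intro z
    rw [intervalIntegral.integral_eq_sub_of_hasDerivAt (fun s _ => h_line z s)
      (Continuous.intervalIntegrable (by fun_prop) _ _), zero_smul, add_zero]
  have h_const : ∫ z, (ψ (y + σ • z) - ψ y) ∂μ = ∫ z, ψ (y + σ • z) ∂μ - ψ y := by
    rw [integral_sub (integrable_comp_add_smul hd hσ hG1 h1) (integrable_const _)]
    simp
  rw [← h_const]
  simp_rw [h_ftc, intervalIntegral.integral_of_le hσ]
  refine integral_integral_swap ((hG1.comp_fst (volume.restrict (Set.Ioc 0 σ))).mono'
    (Continuous.aestronglyMeasurable (by unfold Function.uncurry; fun_prop)) ?_)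
  filter_upwards [Measure.quasiMeasurePreserving_snd.ae
    (ae_restrict_mem (μ := volume) (measurableSet_Ioc (a := (0 : ℝ)) (b := σ)))] with p hp
  refine (ContinuousLinearMap.le_opNorm _ _).trans ?_
  rw [mul_comm]
  exact mul_le_mul_of_nonneg_left (h1 _ _ ⟨hp.1.le, hp.2⟩) (norm_nonneg _)

theorem abs_integral_comp_add_smul_stdGaussian_sub_le {F : E → ℝ} (hF : ContDiff ℝ 2 F)
    (hs : 0 ≤ s) (hG2 : Integrable (fun z => ‖z‖ ^ 2 * G z) (stdGaussian E))
    (h2 : ∀ z, ∀ c ∈ Set.Icc 0 s, ‖fderiv ℝ (fderiv ℝ F) (y + c • z)‖ ≤ G z) :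
    |∫ z, F (y + s • z) ∂(stdGaussian E) - F y| ≤ s ^ 2 * ∫ z, ‖z‖ ^ 2 * G z ∂(stdGaussian E) := by
  have hFc : Continuous F := hF.continuous
  have h_linear : Integrable (fun z => fderiv ℝ F y (s • z)) (stdGaussian E) :=
    (fderiv ℝ F y).integrable_comp (IsGaussian.integrable_id.smul s)
  have h_taylor : ∀ z, ‖F (y + s • z) - F y - fderiv ℝ F y (s • z)‖ ≤ s ^ 2 * (‖z‖ ^ 2 * G z) := by
    intro z
    refine (norm_image_add_sub_sub_fderiv_le hF (G := G z) fun c hc => ?_).trans_eq ?_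
    · rw [smul_smul]
      exact h2 z _ ⟨mul_nonneg hc.1 hs, mul_le_of_le_one_left hs hc.2⟩
    · rw [norm_smul, Real.norm_of_nonneg hs]
      ring
  have h_remainder : Integrable (fun z => F (y + s • z) - F y - fderiv ℝ F y (s • z))
      (stdGaussian E) :=
    (hG2.const_mul (s ^ 2)).mono' (by fun_prop) (ae_of_all _ h_taylor)
  have h_mean : ∫ z, (F (y + s • z) - F y - fderiv ℝ F y (s • z)) ∂(stdGaussian E)
      = ∫ z, F (y + s • z) ∂(stdGaussian E) - F y := by
    have h_diff : Integrable (fun z => F (y + s • z) - F y) (stdGaussian E) :=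
      (h_remainder.add h_linear).congr (ae_of_all _ fun z => sub_add_cancel _ _)
    have h_int : Integrable (fun z => F (y + s • z)) (stdGaussian E) :=
      (h_diff.add (integrable_const (F y))).congr (ae_of_all _ fun z => sub_add_cancel _ _)
    rw [integral_sub h_diff h_linear, integral_sub h_int (integrable_const _)]
    simp only [map_smul, smul_eq_mul, integral_const_mul, integral_strongDual_stdGaussian]
    simp
  rw [← h_mean, ← integral_const_mul]
  exact norm_integral_le_of_norm_le (hG2.const_mul _) (ae_of_all _ h_taylor)

theorem abs_integral_comp_add_smul_stdGaussian_sub_laplacian_le {ψ : E → ℝ} (hψ : ContDiff ℝ 2 ψ)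
    (hΔ : ContDiff ℝ 2 (Δ ψ)) (hσ : 0 ≤ σ) (hG : Integrable G (stdGaussian E))
    (hG2 : Integrable (fun z => ‖z‖ ^ 2 * G z) (stdGaussian E))
    (h1 : ∀ z, ∀ s ∈ Set.Icc 0 σ, ‖fderiv ℝ ψ (y + s • z)‖ ≤ G z)
    (h2 : ∀ z, ∀ s ∈ Set.Icc 0 σ, ‖fderiv ℝ (fderiv ℝ ψ) (y + s • z)‖ ≤ G z)
    (h3 : ∀ z, ∀ s ∈ Set.Icc 0 σ, ‖fderiv ℝ (fderiv ℝ (Δ ψ)) (y + s • z)‖ ≤ G z) :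
    |∫ z, ψ (y + σ • z) ∂(stdGaussian E) - ψ y - σ ^ 2 / 2 * Δ ψ y|
      ≤ σ ^ 4 / 4 * ∫ z, ‖z‖ ^ 2 * G z ∂(stdGaussian E) := by
  have hG1 := integrable_norm_mul hG hG2
  have hΔc : Continuous (Δ ψ) := hΔ.continuous
  have h_heat : Set.EqOn (fun s => ∫ z, fderiv ℝ ψ (y + s • z) z ∂(stdGaussian E))
      (fun s => s * ∫ z, Δ ψ (y + s • z) ∂(stdGaussian E)) (Set.uIcc 0 σ) := by
    intro s hs
    rw [Set.uIcc_of_le hσ] at hs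
    exact integral_fderiv_add_smul_stdGaussian hψ hG hG1 (fun z => h1 z s hs) (fun z => h2 z s hs)
  rw [integral_comp_add_smul_sub_eq_intervalIntegral (hψ.of_le (by norm_num)) hσ hG1 h1,
    intervalIntegral.integral_congr h_heat]
  refine abs_intervalIntegral_mul_sub_le ?_ hσ fun s hs =>
    abs_integral_comp_add_smul_stdGaussian_sub_le hΔ hs.1 hG2
      fun z c hc => h3 z c ⟨hc.1, hc.2.trans hs.2⟩
  exact StronglyMeasurable.integral_prod_right' (ν := stdGaussian E)
    (f := fun p : ℝ × E => Δ ψ (y + p.1 • p.2)) (Continuous.stronglyMeasurable (by fun_prop))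

end Heat

section OneStep

variable {E : Type*} [NormedAddCommGroup E] [InnerProductSpace ℝ E] [FiniteDimensional ℝ E]
  [MeasurableSpace E] {β : Type*}

/-- The part `½ Dψ(u) + ½ Δψ` of the generator of the diffusion `dθ = ½ u(θ) dt + dW`. -/
def driftGenerator (u : E → E) (ψ : E → ℝ) (θ : E) : ℝ :=
  1 / 2 * (fderiv ℝ ψ θ (u θ) + Δ ψ θ)

/-- One Euler step of size `h` from `θ`, driven by a batch `ξ.1` and a Gaussian vector `ξ.2`. -/
def step (v : β → E → E) (h : ℝ) (θ : E) (ξ : β × E) : E :=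
  θ + (h / 2) • v ξ.1 θ + √h • ξ.2

/-- The largest value of `W` at `θ` and at the two ends of a step with the noise `± ξ.2`. The drift
point `θ + (h / 2) v(θ)`, which is not a state of the chain, is the midpoint of these two ends. -/
def envelope (W : E → ℝ) (v : β → E → E) (h : ℝ) (θ : E) (ξ : β × E) : ℝ :=
  max (W θ) (max (W (step v h θ ξ)) (W (step v h θ (ξ.1, -ξ.2))))

/-- The quantity that dominates the error terms of one step. -/
def dominator (W : E → ℝ) (v : β → E → E) (a q h : ℝ) (θ : E) (ξ : β × E) : ℝ :=
  ‖ξ.2‖ ^ ((a + 2 * q) / q) + (W θ ^ (a + 2 * q) + (W (step v h θ ξ) ^ (a + 2 * q)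
    + W (step v h θ (ξ.1, -ξ.2)) ^ (a + 2 * q)))

/-- A function `W ≥ 1` that is controlled along segments and whose powers dominate `ψ`, its
Laplacian, their derivatives up to order two, and the drifts `v b`. -/
structure GrowthBounds (W ψ : E → ℝ) (v : β → E → E) (A κ a q : ℝ) : Prop where
  one_le_A : 1 ≤ A
  one_le_κ : 1 ≤ κ
  a_pos : 0 < a
  q_pos : 0 < q
  measurable : Measurable W
  one_le : ∀ θ, 1 ≤ W θ
  segment : ∀ θ u : E, ∀ c ∈ Set.Icc (0 : ℝ) 1, W (θ + c • u) ≤ κ * max (W θ) (W (θ + u))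
  contDiff : ContDiff ℝ 2 ψ
  contDiff_laplacian : ContDiff ℝ 2 (Δ ψ)
  abs_sol_le : ∀ θ, |ψ θ| ≤ A * W θ ^ a
  norm_fderiv_le : ∀ θ, ‖fderiv ℝ ψ θ‖ ≤ A * W θ ^ a
  norm_fderiv_fderiv_le : ∀ θ, ‖fderiv ℝ (fderiv ℝ ψ) θ‖ ≤ A * W θ ^ a
  abs_laplacian_le : ∀ θ, |Δ ψ θ| ≤ A * W θ ^ a
  norm_fderiv_laplacian_le : ∀ θ, ‖fderiv ℝ (Δ ψ) θ‖ ≤ A * W θ ^ a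
  norm_fderiv_fderiv_laplacian_le : ∀ θ, ‖fderiv ℝ (fderiv ℝ (Δ ψ)) θ‖ ≤ A * W θ ^ a
  continuous_drift : ∀ b, Continuous (v b)
  norm_drift_le : ∀ b θ, ‖v b θ‖ ≤ A * W θ ^ q

/-- The constant by which the derivatives along a step are bounded in terms of the envelope. -/
def growthConst (A κ a : ℝ) : ℝ := A * (κ ^ 2) ^ a

theorem sq_mul_rpow_le {x y a q : ℝ} (hx : 0 ≤ x) (hy : 0 ≤ y) (ha : 0 < a) (hq : 0 < q) :
    x ^ 2 * y ^ a ≤ x ^ ((a + 2 * q) / q) + y ^ (a + 2 * q) := by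
  have h_conj : ((a + 2 * q) / (2 * q)).HolderConjugate ((a + 2 * q) / a) := by
    rw [Real.holderConjugate_iff, lt_div_iff₀ (by positivity)]
    exact ⟨by linarith, by field_simp; ring⟩
  have hx_pow : (x ^ 2) ^ ((a + 2 * q) / (2 * q)) = x ^ ((a + 2 * q) / q) := by
    rw [← Real.rpow_natCast_mul hx]; congr 1; push_cast; field_simp
  have hy_pow : (y ^ a) ^ ((a + 2 * q) / a) = y ^ (a + 2 * q) := by
    rw [← Real.rpow_mul hy]; congr 1; field_simp
  have h_young := Real.young_inequality_of_nonneg (sq_nonneg x) (Real.rpow_nonneg hy a) h_conj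
  rw [hx_pow, hy_pow] at h_young
  exact h_young.trans (add_le_add (div_le_self (Real.rpow_nonneg hx _) h_conj.lt.le)
    (div_le_self (Real.rpow_nonneg hy _) h_conj.symm.lt.le))

namespace GrowthBounds

variable {W ψ : E → ℝ} {v : β → E → E} {A κ a q h : ℝ} {θ : E} {b : β} {z : E}
  (hW : GrowthBounds W ψ v A κ a q)

include hW

theorem pos (θ : E) : 0 < W θ := zero_lt_one.trans_le (hW.one_le θ)

theorem one_le_envelope : 1 ≤ envelope W v h θ (b, z) :=
  (hW.one_le θ).trans (le_max_left _ _)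

theorem envelope_rpow_nonneg (c : ℝ) : 0 ≤ envelope W v h θ (b, z) ^ c :=
  Real.rpow_nonneg (zero_le_one.trans hW.one_le_envelope) c

theorem rpow_envelope_le :
    envelope W v h θ (b, z) ^ (a + 2 * q) ≤ W θ ^ (a + 2 * q) + (W (step v h θ (b, z)) ^ (a + 2 * q)
      + W (step v h θ (b, -z)) ^ (a + 2 * q)) := by
  have h_nonneg : ∀ θ', 0 ≤ W θ' ^ (a + 2 * q) := fun θ' => Real.rpow_nonneg (hW.pos θ').le _
  have h1 := h_nonneg θ
  have h2 := h_nonneg (step v h θ (b, z))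
  have h3 := h_nonneg (step v h θ (b, -z))
  unfold envelope
  rcases max_choice (W θ) (max (W (step v h θ (b, z))) (W (step v h θ (b, -z)))) with e | e <;>
    rw [e]
  · linarith
  · rcases max_choice (W (step v h θ (b, z))) (W (step v h θ (b, -z))) with e' | e' <;>
      rw [e'] <;> linarith

theorem rpow_envelope_mul_pow_le_dominator {k : ℕ} (hk : k ≤ 2) :
    envelope W v h θ (b, z) ^ a * (envelope W v h θ (b, z) ^ q) ^ k
      ≤ dominator W v a q h θ (b, z) := by
  have hY := hW.one_le_envelope (h := h) (θ := θ) (b := b) (z := z)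
  rw [← Real.rpow_mul_natCast (by linarith), ← Real.rpow_add (by linarith)]
  have hkq : q * k ≤ q * 2 := mul_le_mul_of_nonneg_left (by exact_mod_cast hk) hW.q_pos.le
  calc envelope W v h θ (b, z) ^ (a + q * k)
      ≤ envelope W v h θ (b, z) ^ (a + 2 * q) :=
        Real.rpow_le_rpow_of_exponent_le hY (by linarith)
    _ ≤ _ := hW.rpow_envelope_le
    _ ≤ _ := le_add_of_nonneg_left (Real.rpow_nonneg (norm_nonneg _) _)

theorem norm_pow_mul_rpow_envelope_le_dominator {k : ℕ} (hk : k ≤ 2) :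
    ‖z‖ ^ k * envelope W v h θ (b, z) ^ a ≤ dominator W v a q h θ (b, z) := by
  have h_zero : envelope W v h θ (b, z) ^ a ≤ dominator W v a q h θ (b, z) := by
    simpa using hW.rpow_envelope_mul_pow_le_dominator (h := h) (θ := θ) (b := b) (z := z)
      (k := 0) (by norm_num)
  have h_two : ‖z‖ ^ 2 * envelope W v h θ (b, z) ^ a ≤ dominator W v a q h θ (b, z) :=
    (sq_mul_rpow_le (norm_nonneg z) (zero_le_one.trans hW.one_le_envelope) hW.a_pos
      hW.q_pos).trans (add_le_add_right hW.rpow_envelope_le _)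
  interval_cases k
  · simpa using h_zero
  · rw [pow_one]
    nlinarith [mul_nonneg (hW.envelope_rpow_nonneg (h := h) (θ := θ) (b := b) (z := z) a)
      (sq_nonneg (‖z‖ - 1))]
  · exact h_two

theorem dominator_nonneg : 0 ≤ dominator W v a q h θ (b, z) := by
  have h_rpow := hW.rpow_envelope_mul_pow_le_dominator (h := h) (θ := θ) (b := b) (z := z)
    (k := 0) (by norm_num)
  rw [pow_zero, mul_one] at h_rpow
  exact (hW.envelope_rpow_nonneg a).trans h_rpow

theorem one_le_rpow_sq_κ : 1 ≤ (κ ^ 2) ^ a :=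
  Real.one_le_rpow (one_le_pow₀ hW.one_le_κ) hW.a_pos.le

theorem A_le_growthConst : A ≤ growthConst A κ a :=
  le_mul_of_one_le_right (zero_le_one.trans hW.one_le_A) hW.one_le_rpow_sq_κ

theorem one_le_growthConst : 1 ≤ growthConst A κ a := hW.one_le_A.trans hW.A_le_growthConst

theorem le_growthConst_mul {x : ℝ} {θ' : E} (hx : x ≤ A * W θ' ^ a)
    (hθ' : W θ' ≤ κ ^ 2 * envelope W v h θ (b, z)) :
    x ≤ growthConst A κ a * envelope W v h θ (b, z) ^ a := by
  rw [growthConst, mul_assoc,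
    ← Real.mul_rpow (sq_nonneg κ) (zero_le_one.trans hW.one_le_envelope)]
  exact hx.trans (mul_le_mul_of_nonneg_left
    (Real.rpow_le_rpow (hW.pos θ').le hθ' hW.a_pos.le) (zero_le_one.trans hW.one_le_A))

theorem apply_drift_point_le : W (θ + (h / 2) • v b θ) ≤ κ * envelope W v h θ (b, z) := by
  have h_segment := hW.segment (step v h θ (b, z)) (-(2 : ℝ) • √h • z) (1 / 2) (by norm_num)
  have h_mid : step v h θ (b, z) + (1 / 2 : ℝ) • (-(2 : ℝ) • √h • z) = θ + (h / 2) • v b θ := by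
    simp only [step]; module
  have h_end : step v h θ (b, z) + -(2 : ℝ) • √h • z = step v h θ (b, -z) := by
    simp only [step]; module
  rw [h_mid, h_end] at h_segment
  exact h_segment.trans (mul_le_mul_of_nonneg_left (le_max_right _ _)
    (zero_le_one.trans hW.one_le_κ))

theorem le_of_le_max_drift_point {w x : ℝ} (hx : x ≤ envelope W v h θ (b, z))
    (hw : w ≤ κ * max x (W (θ + (h / 2) • v b θ))) : w ≤ κ ^ 2 * envelope W v h θ (b, z) := by
  have hκ := hW.one_le_κ
  rw [pow_two, mul_assoc]
  refine hw.trans (mul_le_mul_of_nonneg_left (max_le (hx.trans ?_) hW.apply_drift_point_le)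
    (by linarith))
  exact le_mul_of_one_le_left (zero_le_one.trans hW.one_le_envelope) hκ

theorem apply_drift_segment_le {c : ℝ} (hc : c ∈ Set.Icc (0 : ℝ) 1) :
    W (θ + c • (h / 2) • v b θ) ≤ κ ^ 2 * envelope W v h θ (b, z) :=
  hW.le_of_le_max_drift_point (le_max_left _ _) (hW.segment θ _ c hc)

theorem apply_noise_segment_le (hh : 0 < h) {s : ℝ} (hs : s ∈ Set.Icc 0 √h) :
    W (θ + (h / 2) • v b θ + s • z) ≤ κ ^ 2 * envelope W v h θ (b, z) := by
  have h_sqrt : 0 < √h := Real.sqrt_pos.2 hh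
  have h_segment := hW.segment (θ + (h / 2) • v b θ) (√h • z) (s / √h)
    ⟨div_nonneg hs.1 h_sqrt.le, (div_le_one h_sqrt).2 hs.2⟩
  rw [smul_smul, div_mul_cancel₀ _ h_sqrt.ne', max_comm] at h_segment
  exact hW.le_of_le_max_drift_point ((le_max_left _ _).trans (le_max_right _ _)) h_segment

theorem apply_step_segment_le {c : ℝ} (hc : c ∈ Set.Icc (0 : ℝ) 1) :
    W (θ + c • ((h / 2) • v b θ + √h • z)) ≤ κ ^ 2 * envelope W v h θ (b, z) := by
  have h_segment := hW.segment θ ((h / 2) • v b θ + √h • z) c hc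
  rw [← add_assoc] at h_segment
  calc W (θ + c • ((h / 2) • v b θ + √h • z))
      ≤ κ * envelope W v h θ (b, z) := h_segment.trans (mul_le_mul_of_nonneg_left
        (max_le (le_max_left _ _) ((le_max_left _ _).trans (le_max_right _ _)))
        (zero_le_one.trans hW.one_le_κ))
    _ ≤ κ ^ 2 * envelope W v h θ (b, z) := mul_le_mul_of_nonneg_right
        (le_self_pow₀ hW.one_le_κ (by norm_num)) (zero_le_one.trans hW.one_le_envelope)

theorem norm_drift_le_envelope :
    ‖v b θ‖ ≤ growthConst A κ a * envelope W v h θ (b, z) ^ q :=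
  (hW.norm_drift_le b θ).trans (mul_le_mul hW.A_le_growthConst
    (Real.rpow_le_rpow (hW.pos θ).le (le_max_left _ _) hW.q_pos.le)
    (Real.rpow_nonneg (hW.pos θ).le _) (zero_le_one.trans hW.one_le_growthConst))

theorem norm_smul_drift_le (hh : 0 ≤ h) :
    ‖(h / 2) • v b θ‖ ≤ h / 2 * (growthConst A κ a * envelope W v h θ (b, z) ^ q) := by
  rw [norm_smul, Real.norm_of_nonneg (by positivity)]
  exact mul_le_mul_of_nonneg_left hW.norm_drift_le_envelope (by positivity)

theorem abs_sol_step_sub_le (hh : 0 < h) (hh1 : h ≤ 1) :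
    |ψ (step v h θ (b, z)) - ψ θ|
      ≤ 2 * growthConst A κ a ^ 2 * √h * dominator W v a q h θ (b, z) := by
  have hL := hW.one_le_growthConst
  have h_mvt := norm_image_add_sub_le (hW.contDiff.differentiable (by norm_num)) (x := θ)
    (u := (h / 2) • v b θ + √h • z) (fun c hc =>
      hW.le_growthConst_mul (hW.norm_fderiv_le _) (hW.apply_step_segment_le hc))
  have h_noise : envelope W v h θ (b, z) ^ a * ‖z‖ ≤ dominator W v a q h θ (b, z) := by
    simpa [mul_comm] using hW.norm_pow_mul_rpow_envelope_le_dominator (k := 1) (by norm_num)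
  have h_drift := hW.rpow_envelope_mul_pow_le_dominator (h := h) (θ := θ) (b := b) (z := z)
    (k := 1) (by norm_num)
  rw [pow_one] at h_drift
  have hv := hW.norm_smul_drift_le (θ := θ) (b := b) (z := z) hh.le
  have hYa := hW.envelope_rpow_nonneg (h := h) (θ := θ) (b := b) (z := z) a
  have hYq := hW.envelope_rpow_nonneg (h := h) (θ := θ) (b := b) (z := z) q
  have hD := hW.dominator_nonneg (h := h) (θ := θ) (b := b) (z := z)
  rw [show step v h θ (b, z) = θ + ((h / 2) • v b θ + √h • z) from add_assoc _ _ _,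
    ← Real.norm_eq_abs]
  generalize growthConst A κ a = L at *
  generalize envelope W v h θ (b, z) ^ a = Ya at *
  generalize envelope W v h θ (b, z) ^ q = Yq at *
  generalize dominator W v a q h θ (b, z) = D at *
  have h_sqrt : h ≤ √h := Real.le_sqrt_of_sq_le (by nlinarith)
  have hu : ‖(h / 2) • v b θ + √h • z‖ ≤ √h * (L * Yq + ‖z‖) := by
    refine (norm_add_le _ _).trans ?_
    rw [norm_smul (√h), Real.norm_of_nonneg (Real.sqrt_nonneg h), mul_add]
    exact add_le_add (hv.trans (mul_le_mul_of_nonneg_right (by linarith) (by positivity))) le_rfl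
  calc ‖ψ (θ + ((h / 2) • v b θ + √h • z)) - ψ θ‖
      ≤ L * Ya * (√h * (L * Yq + ‖z‖)) :=
        h_mvt.trans (mul_le_mul_of_nonneg_left hu (by positivity))
    _ = L ^ 2 * √h * (Ya * Yq) + L * √h * (Ya * ‖z‖) := by ring
    _ ≤ L ^ 2 * √h * D + L ^ 2 * √h * D := by
        gcongr
        exact le_self_pow₀ hL (by norm_num)
    _ = 2 * L ^ 2 * √h * D := by ring

theorem abs_sol_drift_expansion_le (hh : 0 ≤ h) :
    |ψ (θ + (h / 2) • v b θ) - ψ θ - h / 2 * fderiv ℝ ψ θ (v b θ)|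
      ≤ growthConst A κ a ^ 3 * h ^ 2 * dominator W v a q h θ (b, z) := by
  have h_taylor := norm_image_add_sub_sub_fderiv_le hW.contDiff (x := θ) (u := (h / 2) • v b θ)
    (fun c hc => hW.le_growthConst_mul (hW.norm_fderiv_fderiv_le _)
      (hW.apply_drift_segment_le (z := z) hc))
  rw [map_smul, smul_eq_mul, Real.norm_eq_abs] at h_taylor
  have hL := hW.one_le_growthConst
  have hYa := hW.envelope_rpow_nonneg (h := h) (θ := θ) (b := b) (z := z) a
  have h_dom := hW.rpow_envelope_mul_pow_le_dominator (h := h) (θ := θ) (b := b) (z := z) le_rfl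
  have := hW.dominator_nonneg (h := h) (θ := θ) (b := b) (z := z)
  calc _ ≤ growthConst A κ a * envelope W v h θ (b, z) ^ a
        * (h / 2 * (growthConst A κ a * envelope W v h θ (b, z) ^ q)) ^ 2 :=
        h_taylor.trans (mul_le_mul_of_nonneg_left
          (pow_le_pow_left₀ (norm_nonneg _) (hW.norm_smul_drift_le hh) 2) (by positivity))
    _ = growthConst A κ a ^ 3 * (h ^ 2 / 4)
        * (envelope W v h θ (b, z) ^ a * (envelope W v h θ (b, z) ^ q) ^ 2) := by ring
    _ ≤ growthConst A κ a ^ 3 * h ^ 2 * dominator W v a q h θ (b, z) := by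
        gcongr
        linarith [sq_nonneg h]

theorem abs_laplacian_drift_sub_le (hh : 0 ≤ h) :
    |Δ ψ (θ + (h / 2) • v b θ) - Δ ψ θ|
      ≤ growthConst A κ a ^ 3 * h * dominator W v a q h θ (b, z) := by
  have h_mvt := norm_image_add_sub_le (hW.contDiff_laplacian.differentiable (by norm_num)) (x := θ)
    (u := (h / 2) • v b θ) (fun c hc => hW.le_growthConst_mul (hW.norm_fderiv_laplacian_le _)
      (hW.apply_drift_segment_le (z := z) hc))
  have hL := hW.one_le_growthConst
  have hYa := hW.envelope_rpow_nonneg (h := h) (θ := θ) (b := b) (z := z) a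
  have h_dom := hW.rpow_envelope_mul_pow_le_dominator (h := h) (θ := θ) (b := b) (z := z)
    (k := 1) (by norm_num)
  rw [pow_one] at h_dom
  have hYq := hW.envelope_rpow_nonneg (h := h) (θ := θ) (b := b) (z := z) q
  have := hW.dominator_nonneg (h := h) (θ := θ) (b := b) (z := z)
  calc _ ≤ growthConst A κ a * envelope W v h θ (b, z) ^ a
        * (h / 2 * (growthConst A κ a * envelope W v h θ (b, z) ^ q)) :=
        h_mvt.trans (mul_le_mul_of_nonneg_left (hW.norm_smul_drift_le hh) (by positivity))
    _ = growthConst A κ a ^ 2 * (h / 2)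
        * (envelope W v h θ (b, z) ^ a * envelope W v h θ (b, z) ^ q) := by ring
    _ ≤ growthConst A κ a ^ 3 * h * dominator W v a q h θ (b, z) := by
        gcongr
        · norm_num
        · exact half_le_self hh

theorem abs_drift_add_laplacian_sub_le (hh : 0 ≤ h) :
    |ψ (θ + (h / 2) • v b θ) + h / 2 * Δ ψ (θ + (h / 2) • v b θ) - ψ θ
        - h * driftGenerator (v b) ψ θ|
      ≤ 2 * growthConst A κ a ^ 3 * h ^ 2 * dominator W v a q h θ (b, z) := by
  have h_expansion := hW.abs_sol_drift_expansion_le (θ := θ) (b := b) (z := z) hh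
  have h_nonneg : 0 ≤ growthConst A κ a ^ 3 * h ^ 2 * dominator W v a q h θ (b, z) :=
    (abs_nonneg _).trans h_expansion
  have h_laplacian : |h / 2 * (Δ ψ (θ + (h / 2) • v b θ) - Δ ψ θ)|
      ≤ h / 2 * (growthConst A κ a ^ 3 * h * dominator W v a q h θ (b, z)) := by
    rw [abs_mul, abs_of_nonneg (div_nonneg hh two_pos.le)]
    exact mul_le_mul_of_nonneg_left (hW.abs_laplacian_drift_sub_le hh) (div_nonneg hh two_pos.le)
  calc _ = |(ψ (θ + (h / 2) • v b θ) - ψ θ - h / 2 * fderiv ℝ ψ θ (v b θ))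
        + h / 2 * (Δ ψ (θ + (h / 2) • v b θ) - Δ ψ θ)| := by
        congr 1; unfold driftGenerator; ring
    _ ≤ _ := abs_add_le _ _
    _ ≤ 2 * growthConst A κ a ^ 3 * h ^ 2 * dominator W v a q h θ (b, z) := by linarith

end GrowthBounds

end OneStep

section OneStepMean

variable {E : Type*} [NormedAddCommGroup E] [InnerProductSpace ℝ E] [FiniteDimensional ℝ E]
  [MeasurableSpace E] [BorelSpace E] {β : Type*} [MeasurableSpace β] [Countable β]
  [MeasurableSingletonClass β]

theorem measurable_step {v : β → E → E} (hv : ∀ b, Continuous (v b)) (h : ℝ) :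
    Measurable fun x : E × (β × E) => step v h x.1 x.2 := by
  have h_drift : Measurable fun x : E × β => v x.2 x.1 :=
    measurable_from_prod_countable_left fun b => (hv b).measurable
  have h_drift' : Measurable fun x : E × (β × E) => v x.2.1 x.1 :=
    h_drift.comp (measurable_fst.prodMk (measurable_fst.comp measurable_snd))
  exact (measurable_fst.add (h_drift'.const_smul (h / 2))).add
    ((measurable_snd.comp measurable_snd).const_smul √h)

namespace GrowthBounds

variable {W ψ : E → ℝ} {v : β → E → E} {A κ a q h : ℝ} {θ : E} {b : β}
  (hW : GrowthBounds W ψ v A κ a q)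

include hW

theorem measurable_apply_step (h : ℝ) :
    Measurable fun x : E × (β × E) => W (step v h x.1 x.2) :=
  hW.measurable.comp (measurable_step hW.continuous_drift h)

theorem measurable_apply_reflected_step (h : ℝ) :
    Measurable fun x : E × (β × E) => W (step v h x.1 (x.2.1, -x.2.2)) :=
  (hW.measurable_apply_step h).comp
    (by fun_prop : Measurable fun x : E × (β × E) => (x.1, (x.2.1, -x.2.2)))

theorem measurable_dominator (h : ℝ) :
    Measurable fun x : E × (β × E) => dominator W v a q h x.1 x.2 :=
  ((measurable_snd.comp measurable_snd).norm.pow_const _).add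
    (((hW.measurable.comp measurable_fst).pow_const _).add
      (((hW.measurable_apply_step h).pow_const _).add
        ((hW.measurable_apply_reflected_step h).pow_const _)))

theorem measurable_envelope (h : ℝ) :
    Measurable fun x : E × (β × E) => envelope W v h x.1 x.2 :=
  (hW.measurable.comp measurable_fst).max
    ((hW.measurable_apply_step h).max (hW.measurable_apply_reflected_step h))

theorem integrable_norm_pow_mul_rpow_envelope {k : ℕ} (hk : k ≤ 2)
    (hD : Integrable (fun z => dominator W v a q h θ (b, z)) (stdGaussian E)) :
    Integrable (fun z => ‖z‖ ^ k * envelope W v h θ (b, z) ^ a) (stdGaussian E) := by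
  have h_meas : Measurable fun z => envelope W v h θ (b, z) :=
    (hW.measurable_envelope h).comp (by fun_prop : Measurable fun z : E => (θ, (b, z)))
  refine hD.mono' (by fun_prop) (ae_of_all _ fun z => ?_)
  rw [Real.norm_of_nonneg (mul_nonneg (by positivity) (hW.envelope_rpow_nonneg a))]
  exact hW.norm_pow_mul_rpow_envelope_le_dominator hk

theorem abs_integral_noise_sub_le (hh : 0 < h)
    (hD : Integrable (fun z => dominator W v a q h θ (b, z)) (stdGaussian E)) :
    |∫ z, ψ (step v h θ (b, z)) ∂(stdGaussian E) - ψ (θ + (h / 2) • v b θ)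
        - h / 2 * Δ ψ (θ + (h / 2) • v b θ)|
      ≤ growthConst A κ a ^ 3 * h ^ 2 * ∫ z, dominator W v a q h θ (b, z) ∂(stdGaussian E) := by
  have hL := hW.one_le_growthConst
  have hY0 := (hW.integrable_norm_pow_mul_rpow_envelope (k := 0) (by norm_num) hD).const_mul
    (growthConst A κ a)
  have hY2 := (hW.integrable_norm_pow_mul_rpow_envelope le_rfl hD).const_mul (growthConst A κ a)
  simp only [pow_zero, one_mul] at hY0
  simp only [mul_left_comm (growthConst A κ a)] at hY2
  have h_heat := abs_integral_comp_add_smul_stdGaussian_sub_laplacian_le hW.contDiff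
    hW.contDiff_laplacian (Real.sqrt_nonneg h) hY0 hY2
    (fun z s hs => hW.le_growthConst_mul (hW.norm_fderiv_le _) (hW.apply_noise_segment_le hh hs))
    (fun z s hs => hW.le_growthConst_mul (hW.norm_fderiv_fderiv_le _)
      (hW.apply_noise_segment_le hh hs))
    (fun z s hs => hW.le_growthConst_mul (hW.norm_fderiv_fderiv_laplacian_le _)
      (hW.apply_noise_segment_le hh hs))
  have h_integral : ∫ z, ‖z‖ ^ 2 * (growthConst A κ a * envelope W v h θ (b, z) ^ a)
      ∂(stdGaussian E)
      ≤ growthConst A κ a * ∫ z, dominator W v a q h θ (b, z) ∂(stdGaussian E) := by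
    rw [← integral_const_mul]
    refine integral_mono hY2 (hD.const_mul _) fun z => ?_
    rw [mul_left_comm]
    exact mul_le_mul_of_nonneg_left (hW.norm_pow_mul_rpow_envelope_le_dominator le_rfl)
      (by linarith)
  have hD_nonneg : 0 ≤ ∫ z, dominator W v a q h θ (b, z) ∂(stdGaussian E) :=
    integral_nonneg fun z => hW.dominator_nonneg
  rw [Real.sq_sqrt hh.le, show √h ^ 4 = (√h ^ 2) ^ 2 by ring, Real.sq_sqrt hh.le] at h_heat
  calc _ ≤ h ^ 2 / 4 * _ := h_heat
    _ ≤ h ^ 2 * (growthConst A κ a * ∫ z, dominator W v a q h θ (b, z) ∂(stdGaussian E)) := by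
        refine mul_le_mul (by linarith [sq_nonneg h]) h_integral (integral_nonneg fun z => ?_)
          (sq_nonneg h)
        exact mul_nonneg (sq_nonneg _) (mul_nonneg (by linarith) (hW.envelope_rpow_nonneg a))
    _ = growthConst A κ a * h ^ 2 * ∫ z, dominator W v a q h θ (b, z) ∂(stdGaussian E) := by ring
    _ ≤ _ := by
        gcongr
        exact le_self_pow₀ hL (by norm_num)

theorem abs_integral_step_noise_sub_le (hh : 0 < h)
    (hD : Integrable (fun z => dominator W v a q h θ (b, z)) (stdGaussian E)) :
    |∫ z, ψ (step v h θ (b, z)) ∂(stdGaussian E) - ψ θ - h * driftGenerator (v b) ψ θ|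
      ≤ 3 * growthConst A κ a ^ 3 * h ^ 2
        * ∫ z, dominator W v a q h θ (b, z) ∂(stdGaussian E) := by
  have h_noise := hW.abs_integral_noise_sub_le hh hD
  have h_drift := integral_mono (μ := stdGaussian E) (integrable_const _)
    (hD.const_mul (2 * growthConst A κ a ^ 3 * h ^ 2))
    (fun z => hW.abs_drift_add_laplacian_sub_le (θ := θ) (b := b) (z := z) hh.le)
  rw [integral_const, probReal_univ, one_smul, integral_const_mul] at h_drift
  rw [abs_le] at h_noise h_drift ⊢
  constructor <;> linarith [h_noise.1, h_noise.2, h_drift.1, h_drift.2]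

variable {π : Measure β}

theorem integrable_drift [IsFiniteMeasure π] (θ : E) : Integrable (fun b => v b θ) π :=
  .of_bound (measurable_of_countable _).aestronglyMeasurable (A * W θ ^ q)
    (ae_of_all _ fun b => hW.norm_drift_le b θ)

theorem integrable_driftGenerator [IsFiniteMeasure π] (θ : E) :
    Integrable (fun b => driftGenerator (v b) ψ θ) π :=
  (((fderiv ℝ ψ θ).integrable_comp (hW.integrable_drift θ)).add (integrable_const _)).const_mul _

theorem driftGenerator_integral [IsProbabilityMeasure π] (θ : E) :
    driftGenerator (fun θ => ∫ b, v b θ ∂π) ψ θ = ∫ b, driftGenerator (v b) ψ θ ∂π := by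
  have hv := hW.integrable_drift (π := π) θ
  simp only [driftGenerator]
  rw [integral_const_mul, integral_add ((fderiv ℝ ψ θ).integrable_comp hv) (integrable_const _),
    ContinuousLinearMap.integral_comp_comm _ hv, integral_const, probReal_univ, one_smul]

theorem measurable_driftGenerator_integral [SFinite π] :
    Measurable (driftGenerator (fun θ => ∫ b, v b θ ∂π) ψ) := by
  have h_drift : StronglyMeasurable fun x : E × β => v x.2 x.1 :=
    (measurable_from_prod_countable_left fun b =>
      (hW.continuous_drift b).measurable).stronglyMeasurable
  have h_apply : Continuous fun x : E × E => fderiv ℝ ψ x.1 x.2 := by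
    have := hW.contDiff.continuous_fderiv two_ne_zero
    fun_prop
  exact ((h_apply.measurable.comp (measurable_id.prodMk
    h_drift.integral_prod_right'.measurable)).add
      hW.contDiff_laplacian.continuous.measurable).const_mul _

theorem integrable_sol_step_sub (hh : 0 < h) (hh1 : h ≤ 1)
    (hD : Integrable (dominator W v a q h θ) (π.prod (stdGaussian E))) :
    Integrable (fun ξ => ψ (step v h θ ξ) - ψ θ) (π.prod (stdGaussian E)) := by
  have h_meas : Measurable fun ξ => ψ (step v h θ ξ) - ψ θ :=
    (hW.contDiff.continuous.measurable.comp
      ((measurable_step hW.continuous_drift h).comp measurable_prodMk_left)).sub_const _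
  exact (hD.const_mul _).mono' h_meas.aestronglyMeasurable
    (ae_of_all _ fun ξ => hW.abs_sol_step_sub_le hh hh1)

theorem abs_integral_step_sub_le [IsProbabilityMeasure π] (hh : 0 < h) (hh1 : h ≤ 1)
    (hD : Integrable (dominator W v a q h θ) (π.prod (stdGaussian E))) :
    |∫ ξ, (ψ (step v h θ ξ) - ψ θ) ∂(π.prod (stdGaussian E))
        - h * driftGenerator (fun θ => ∫ b, v b θ ∂π) ψ θ|
      ≤ 3 * growthConst A κ a ^ 3 * h ^ 2
        * ∫ ξ, dominator W v a q h θ ξ ∂(π.prod (stdGaussian E)) := by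
  have h_int := hW.integrable_sol_step_sub hh hh1 hD
  rw [hW.driftGenerator_integral, integral_prod _ h_int, integral_prod _ hD, ← integral_const_mul,
    ← integral_const_mul, ← integral_sub h_int.integral_prod_left
      ((hW.integrable_driftGenerator θ).const_mul h), ← Real.norm_eq_abs]
  refine norm_integral_le_of_norm_le (hD.integral_prod_left.const_mul _) ?_
  filter_upwards [hD.prod_right_ae, h_int.prod_right_ae] with b hDb h_int_b
  have h_int_step := h_int_b.add (integrable_const (ψ θ))
  simp only [Pi.add_def, sub_add_cancel] at h_int_step
  rw [integral_sub h_int_step (integrable_const _), integral_const, probReal_univ, one_smul]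
  exact hW.abs_integral_step_noise_sub_le hh hDb

end GrowthBounds

end OneStepMean

section SecondMoment

variable {Ω : Type*} [MeasurableSpace Ω] {P : Measure Ω} {f g : Ω → ℝ} {c K L : ℝ}

/-- The random variable `g` is square integrable with second moment at most `K`. -/
def SecondMomentLE (P : Measure Ω) (g : Ω → ℝ) (K : ℝ) : Prop :=
  MemLp g 2 P ∧ ∫ ω, g ω ^ 2 ∂P ≤ K

namespace SecondMomentLE

theorem nonneg (hf : SecondMomentLE P f K) : 0 ≤ K :=
  (integral_nonneg fun _ => sq_nonneg _).trans hf.2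

theorem map_iff {α : Type*} [MeasurableSpace α] {X : Ω → α} {g : α → ℝ} (hX : Measurable X)
    (hg : Measurable g) :
    SecondMomentLE (P.map X) g K ↔ SecondMomentLE P (fun ω => g (X ω)) K := by
  rw [SecondMomentLE, memLp_map_measure_iff hg.aestronglyMeasurable hX.aemeasurable,
    integral_map hX.aemeasurable (hg.pow_const 2).aestronglyMeasurable]
  rfl

theorem mono (hf : SecondMomentLE P f K) (hKL : K ≤ L) : SecondMomentLE P f L :=
  ⟨hf.1, hf.2.trans hKL⟩

theorem of_sq_le (hf : Integrable f P) (hK : ∫ ω, f ω ∂P ≤ K) (hg : Measurable g)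
    (h : ∀ ω, g ω ^ 2 ≤ f ω) : SecondMomentLE P g K := by
  have hg2 : Integrable (fun ω => g ω ^ 2) P :=
    hf.mono' (hg.pow_const 2).aestronglyMeasurable
      (.of_forall fun ω => by rw [Real.norm_of_nonneg (sq_nonneg _)]; exact h ω)
  exact ⟨(memLp_two_iff_integrable_sq hg.aestronglyMeasurable).2 hg2,
    (integral_mono hg2 hf h).trans hK⟩

theorem of_abs_le (hf : SecondMomentLE P f K) (hg : Measurable g)
    (h : ∀ᵐ ω ∂P, |g ω| ≤ c * f ω) : SecondMomentLE P g (c ^ 2 * K) := by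
  have h_memLp : MemLp (fun ω => c * f ω) 2 P := hf.1.const_mul c
  have hg2 : MemLp g 2 P := h_memLp.mono' hg.aestronglyMeasurable h
  refine ⟨hg2, (integral_mono_ae hg2.integrable_sq h_memLp.integrable_sq ?_).trans ?_⟩
  · filter_upwards [h] with ω hω
    exact sq_le_sq' (neg_le_of_abs_le hω) (le_of_abs_le hω)
  · simp only [mul_pow]
    rw [integral_const_mul]
    exact mul_le_mul_of_nonneg_left hf.2 (sq_nonneg c)

theorem const_mul (hf : SecondMomentLE P f K) (c : ℝ) :
    SecondMomentLE P (fun ω => c * f ω) (c ^ 2 * K) := by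
  refine ⟨hf.1.const_mul c, ?_⟩
  simp only [mul_pow]
  rw [integral_const_mul]
  exact mul_le_mul_of_nonneg_left hf.2 (sq_nonneg c)

theorem add (hf : SecondMomentLE P f K) (hg : SecondMomentLE P g L) :
    SecondMomentLE P (fun ω => f ω + g ω) (2 * (K + L)) := by
  have h_memLp : MemLp (fun ω => f ω + g ω) 2 P := hf.1.add hg.1
  refine ⟨h_memLp, (integral_mono h_memLp.integrable_sq
    ((hf.1.integrable_sq.add hg.1.integrable_sq).const_mul 2) fun ω => add_sq_le).trans ?_⟩
  rw [integral_const_mul]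
  simp only [Pi.add_apply]
  rw [integral_add hf.1.integrable_sq hg.1.integrable_sq]
  exact mul_le_mul_of_nonneg_left (add_le_add hf.2 hg.2) zero_le_two

theorem neg (hf : SecondMomentLE P f K) : SecondMomentLE P (fun ω => -f ω) K :=
  ⟨hf.1.neg, by simpa only [neg_sq] using hf.2⟩

theorem sub (hf : SecondMomentLE P f K) (hg : SecondMomentLE P g L) :
    SecondMomentLE P (fun ω => f ω - g ω) (2 * (K + L)) := by
  simpa only [sub_eq_add_neg] using hf.add hg.neg

theorem sum {ι : Type*} (s : Finset ι) {f : ι → Ω → ℝ} (hf : ∀ i ∈ s, SecondMomentLE P (f i) K) :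
    SecondMomentLE P (fun ω => ∑ i ∈ s, f i ω) ((s.card : ℝ) ^ 2 * K) := by
  have h_memLp : MemLp (fun ω => ∑ i ∈ s, f i ω) 2 P := memLp_finsetSum s fun i hi => (hf i hi).1
  have h_sq : ∀ i ∈ s, Integrable (fun ω => f i ω ^ 2) P := fun i hi => (hf i hi).1.integrable_sq
  refine ⟨h_memLp, ?_⟩
  calc ∫ ω, (∑ i ∈ s, f i ω) ^ 2 ∂P ≤ ∫ ω, (s.card : ℝ) * ∑ i ∈ s, f i ω ^ 2 ∂P :=
        integral_mono h_memLp.integrable_sq ((integrable_finsetSum s h_sq).const_mul _)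
          fun ω => sq_sum_le_card_mul_sum_sq
    _ = (s.card : ℝ) * ∑ i ∈ s, ∫ ω, f i ω ^ 2 ∂P := by
        rw [integral_const_mul, integral_finsetSum s h_sq]
    _ ≤ (s.card : ℝ) * ∑ _i ∈ s, K :=
        mul_le_mul_of_nonneg_left (Finset.sum_le_sum fun i hi => (hf i hi).2) (Nat.cast_nonneg _)
    _ = (s.card : ℝ) ^ 2 * K := by rw [Finset.sum_const, nsmul_eq_mul]; ring

end SecondMomentLE

end SecondMoment

section ProductMeasure

variable {α γ : Type*} [MeasurableSpace α] [MeasurableSpace γ] {μ : Measure α} [SFinite μ]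
  {ν : Measure γ} {f : α × γ → ℝ}

/-- The function `f` minus its mean over the second variable. For a state `x` and an independent
input `y` of law `ν` it is the martingale increment `f (x, y) - 𝔼[f (x, y) | x]`. -/
def centered (ν : Measure γ) (f : α × γ → ℝ) (p : α × γ) : ℝ := f p - ∫ y, f (p.1, y) ∂ν

theorem measurable_integral_right [SFinite ν] (hf : Measurable f) :
    Measurable fun x => ∫ y, f (x, y) ∂ν :=
  hf.stronglyMeasurable.integral_prod_right'.measurable

theorem measurable_centered [SFinite ν] (hf : Measurable f) : Measurable (centered ν f) :=
  hf.sub ((measurable_integral_right hf).comp measurable_fst)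

theorem ae_memLp_two_prodMk_left [SFinite ν] (hf : MemLp f 2 (μ.prod ν)) :
    ∀ᵐ x ∂μ, MemLp (fun y => f (x, y)) 2 ν := by
  filter_upwards [hf.1.prodMk_left, hf.integrable_sq.prod_right_ae] with x hx hx_sq
  exact (memLp_two_iff_integrable_sq hx).2 hx_sq

variable [IsProbabilityMeasure ν]

theorem sq_integral_le_integral_sq {g : γ → ℝ} (hg : MemLp g 2 ν) :
    (∫ y, g y ∂ν) ^ 2 ≤ ∫ y, g y ^ 2 ∂ν := by
  have h_variance := variance_eq_sub hg
  have h_nonneg := variance_nonneg g ν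
  simp only [Pi.pow_apply] at h_variance
  linarith

theorem memLp_two_integral_right (hf : MemLp f 2 (μ.prod ν)) :
    MemLp (fun x => ∫ y, f (x, y) ∂ν) 2 μ := by
  have h_meas : AEStronglyMeasurable (fun x => ∫ y, f (x, y) ∂ν) μ := hf.1.integral_prod_right'
  refine (memLp_two_iff_integrable_sq h_meas).2
    (hf.integrable_sq.integral_prod_left.mono' (h_meas.pow 2) ?_)
  filter_upwards [ae_memLp_two_prodMk_left hf] with x hx
  rw [Real.norm_of_nonneg (sq_nonneg _)]
  exact sq_integral_le_integral_sq hx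

theorem SecondMomentLE.integral_right {K : ℝ} (hf : SecondMomentLE (μ.prod ν) f K) :
    SecondMomentLE μ (fun x => ∫ y, f (x, y) ∂ν) K := by
  refine ⟨memLp_two_integral_right hf.1, le_trans ?_ hf.2⟩
  rw [integral_prod _ hf.1.integrable_sq]
  refine integral_mono_ae (memLp_two_integral_right hf.1).integrable_sq
    hf.1.integrable_sq.integral_prod_left ?_
  filter_upwards [ae_memLp_two_prodMk_left hf.1] with x hx
  exact sq_integral_le_integral_sq hx

theorem memLp_two_centered (hf : MemLp f 2 (μ.prod ν)) :
    MemLp (centered ν f) 2 (μ.prod ν) :=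
  hf.sub ((memLp_two_integral_right hf).comp_fst ν)

theorem SecondMomentLE.centered {K : ℝ} (hf : SecondMomentLE (μ.prod ν) f K) :
    SecondMomentLE (μ.prod ν) (centered ν f) K := by
  have h_centered := (memLp_two_centered hf.1).integrable_sq
  refine ⟨memLp_two_centered hf.1, le_trans ?_ hf.2⟩
  rw [integral_prod _ h_centered, integral_prod _ hf.1.integrable_sq]
  refine integral_mono_ae h_centered.integral_prod_left hf.1.integrable_sq.integral_prod_left ?_
  filter_upwards [ae_memLp_two_prodMk_left hf.1] with x hx
  have h_variance := variance_le_expectation_sq hx.1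
  rwa [variance_eq_integral hx.1.aemeasurable] at h_variance

theorem integral_mul_centered {g : α → ℝ} (hg : MemLp g 2 μ) (hf : MemLp f 2 (μ.prod ν)) :
    ∫ p, g p.1 * centered ν f p ∂(μ.prod ν) = 0 := by
  have h_int : Integrable (fun p => g p.1 * centered ν f p) (μ.prod ν) :=
    (hg.comp_fst ν).integrable_mul (memLp_two_centered hf)
  rw [integral_prod _ h_int]
  refine integral_eq_zero_of_ae ?_
  filter_upwards [ae_memLp_two_prodMk_left hf] with x hx
  simp only [centered, Pi.zero_apply]
  rw [integral_const_mul, integral_sub (hx.integrable one_le_two) (integrable_const _),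
    integral_const, probReal_univ, one_smul, sub_self, mul_zero]

end ProductMeasure

section DrivenSequence

variable {Ω α γ : Type*} [MeasurableSpace Ω] [MeasurableSpace α] [MeasurableSpace γ]
  {P : Measure Ω}

theorem indepFun_prodMk_of_indepFun_prodMk {α' : Type*} [MeasurableSpace α'] [IsFiniteMeasure P]
    {X : Ω → α} {Y : Ω → α'} {V : Ω → γ} (hX : Measurable X) (hY : Measurable Y)
    (hV : Measurable V) (h : IndepFun X (fun ω => (Y ω, V ω)) P) (hYV : IndepFun Y V P) :
    IndepFun (fun ω => (X ω, Y ω)) V P := by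
  have hXY : IndepFun X Y P := h.comp measurable_id measurable_fst
  rw [indepFun_iff_map_prod_eq_prod_map_map (by fun_prop) (by fun_prop)] at h hYV hXY ⊢
  rw [hYV, ← Measure.prodAssoc_prod, ← hXY] at h
  have h_assoc := congrArg (Measure.map MeasurableEquiv.prodAssoc.symm) h
  rw [Measure.map_map (by fun_prop) (by fun_prop), Measure.map_map (by fun_prop) (by fun_prop)]
    at h_assoc
  simp only [Function.comp_def, MeasurableEquiv.symm_apply_apply] at h_assoc
  exact h_assoc.trans Measure.map_id'

/-- `X` is the recursion `X (t + 1) = u (X t, ξ t)` whose inputs `ξ t` are independent of each other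
and of the initial state and have the common law `ν`. -/
structure IsDrivenBy (P : Measure Ω) (ν : Measure γ) (u : α × γ → α) (X : ℕ → Ω → α)
    (ξ : ℕ → Ω → γ) : Prop where
  measurable_update : Measurable u
  measurable_init : Measurable (X 0)
  measurable_input : ∀ t, Measurable (ξ t)
  succ : ∀ t ω, X (t + 1) ω = u (X t ω, ξ t ω)
  map_input : ∀ t, P.map (ξ t) = ν
  iIndepFun_input : iIndepFun ξ P
  indepFun_init : IndepFun (X 0) (fun ω t => ξ t ω) P

namespace IsDrivenBy

variable {ν : Measure γ} {u : α × γ → α} {X : ℕ → Ω → α} {ξ : ℕ → Ω → γ} {f : α × γ → ℝ}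
  (hX : IsDrivenBy P ν u X ξ)

include hX

theorem measurable_state (t : ℕ) : Measurable (X t) := by
  induction t with
  | zero => exact hX.measurable_init
  | succ t ih =>
    rw [show X (t + 1) = fun ω => u (X t ω, ξ t ω) from funext (hX.succ t)]
    exact hX.measurable_update.comp (ih.prodMk (hX.measurable_input t))

theorem measurable_state_input (t : ℕ) : Measurable fun ω => (X t ω, ξ t ω) :=
  (hX.measurable_state t).prodMk (hX.measurable_input t)

theorem exists_measurable_state_eq (t : ℕ) :
    ∃ Φ : α × (Finset.range t → γ) → α, Measurable Φ ∧
      X t = Φ ∘ fun ω => (X 0 ω, fun j : Finset.range t => ξ j ω) := by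
  induction t with
  | zero => exact ⟨Prod.fst, measurable_fst, rfl⟩
  | succ t ih =>
    obtain ⟨Φ, hΦ, h_eq⟩ := ih
    have hu := hX.measurable_update
    refine ⟨fun x => u (Φ (x.1, fun j => x.2 ⟨j, Finset.range_subset_range.2 t.le_succ j.2⟩),
      x.2 ⟨t, Finset.self_mem_range_succ t⟩), by fun_prop, funext fun ω => ?_⟩
    rw [hX.succ, h_eq]
    rfl

theorem indepFun_state_input (t : ℕ) [IsFiniteMeasure P] : IndepFun (X t) (ξ t) P := by
  have h_input := hX.measurable_input
  obtain ⟨Φ, hΦ, h_eq⟩ := hX.exists_measurable_state_eq t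
  have h_past : IndepFun (fun ω (j : Finset.range t) => ξ j ω) (ξ t) P :=
    (hX.iIndepFun_input.indepFun_finset (Finset.range t) {t} (by simp) h_input).comp measurable_id
      (measurable_pi_apply (⟨t, by simp⟩ : ({t} : Finset ℕ)))
  have h_init : IndepFun (X 0) (fun ω => ((fun j : Finset.range t => ξ j ω), ξ t ω)) P :=
    hX.indepFun_init.comp measurable_id
      (by fun_prop : Measurable fun s : ℕ → γ => ((fun j : Finset.range t => s j), s t))
  rw [h_eq]
  exact (indepFun_prodMk_of_indepFun_prodMk hX.measurable_init (by fun_prop) (h_input t) h_init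
    h_past).comp hΦ measurable_id

theorem map_state_input [IsFiniteMeasure P] (t : ℕ) :
    P.map (fun ω => (X t ω, ξ t ω)) = (P.map (X t)).prod ν := by
  rw [(indepFun_iff_map_prod_eq_prod_map_map (hX.measurable_state t).aemeasurable
    (hX.measurable_input t).aemeasurable).1 (hX.indepFun_state_input t), hX.map_input]

theorem isProbabilityMeasure_input [IsProbabilityMeasure P] : IsProbabilityMeasure ν :=
  hX.map_input 0 ▸ Measure.isProbabilityMeasure_map (hX.measurable_input 0).aemeasurable

theorem integral_state_input [IsFiniteMeasure P] (hf : Measurable f) (t : ℕ) :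
    ∫ ω, f (X t ω, ξ t ω) ∂P = ∫ p, f p ∂((P.map (X t)).prod ν) := by
  rw [← hX.map_state_input,
    integral_map (hX.measurable_state_input t).aemeasurable hf.aestronglyMeasurable]

theorem secondMomentLE_state_input_iff [IsFiniteMeasure P] {K : ℝ} (hf : Measurable f) (t : ℕ) :
    SecondMomentLE P (fun ω => f (X t ω, ξ t ω)) K
      ↔ SecondMomentLE ((P.map (X t)).prod ν) f K := by
  rw [← hX.map_state_input, SecondMomentLE.map_iff (hX.measurable_state_input t) hf]

theorem secondMomentLE_centered [IsProbabilityMeasure P] (hf : Measurable f) {t : ℕ} {K : ℝ}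
    (hfK : SecondMomentLE P (fun ω => f (X t ω, ξ t ω)) K) :
    SecondMomentLE P (fun ω => centered ν f (X t ω, ξ t ω)) K := by
  have := hX.isProbabilityMeasure_input
  exact (hX.secondMomentLE_state_input_iff (measurable_centered hf) t).2
    ((hX.secondMomentLE_state_input_iff hf t).1 hfK).centered

theorem secondMomentLE_integral_right [IsProbabilityMeasure P] (hf : Measurable f) {t : ℕ} {K : ℝ}
    (hfK : SecondMomentLE P (fun ω => f (X t ω, ξ t ω)) K) :
    SecondMomentLE P (fun ω => ∫ y, f (X t ω, y) ∂ν) K := by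
  have := hX.isProbabilityMeasure_input
  exact (SecondMomentLE.map_iff (hX.measurable_state t) (measurable_integral_right hf)).1
    ((hX.secondMomentLE_state_input_iff hf t).1 hfK).integral_right

theorem ae_integrable_state [IsProbabilityMeasure P] (hf : Measurable f) {t : ℕ} {K : ℝ}
    (hfK : SecondMomentLE P (fun ω => f (X t ω, ξ t ω)) K) :
    ∀ᵐ ω ∂P, Integrable (fun y => f (X t ω, y)) ν := by
  have := hX.isProbabilityMeasure_input
  have h_ae := ae_memLp_two_prodMk_left ((hX.secondMomentLE_state_input_iff hf t).1 hfK).1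
  filter_upwards [ae_of_ae_map (hX.measurable_state t).aemeasurable h_ae] with ω hω
  exact hω.integrable one_le_two

theorem secondMomentLE_comp_input [IsProbabilityMeasure P] (hf : Measurable f) {t : ℕ} {K : ℝ}
    {σ : γ → γ} (hσ : MeasurePreserving σ ν ν)
    (hfK : SecondMomentLE P (fun ω => f (X t ω, ξ t ω)) K) :
    SecondMomentLE P (fun ω => f (X t ω, σ (ξ t ω))) K := by
  have := hX.isProbabilityMeasure_input
  have h_pres : MeasurePreserving (Prod.map id σ) ((P.map (X t)).prod ν) ((P.map (X t)).prod ν) :=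
    (MeasurePreserving.id _).prod hσ
  rw [hX.secondMomentLE_state_input_iff hf, ← h_pres.map_eq,
    SecondMomentLE.map_iff h_pres.measurable hf] at hfK
  exact (hX.secondMomentLE_state_input_iff (hf.comp h_pres.measurable) t).2 hfK

theorem withSum (hf : Measurable f) :
    IsDrivenBy P ν (fun p : (α × ℝ) × γ => (u (p.1.1, p.2), p.1.2 + f (p.1.1, p.2)))
      (fun t ω => (X t ω, ∑ s ∈ Finset.range t, f (X s ω, ξ s ω))) ξ where
  measurable_update := by
    have hu := hX.measurable_update
    fun_prop
  measurable_init := by simpa using hX.measurable_init.prodMk measurable_const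
  measurable_input := hX.measurable_input
  succ t ω := by simp only [hX.succ, Finset.sum_range_succ]
  map_input := hX.map_input
  iIndepFun_input := hX.iIndepFun_input
  indepFun_init := by
    simpa using! hX.indepFun_init.comp (measurable_id.prodMk (measurable_const (a := (0 : ℝ))))
      measurable_id

theorem integral_sum_mul_centered [IsProbabilityMeasure P] (hf : Measurable f) {V : ℝ}
    (hV : ∀ t, SecondMomentLE P (fun ω => f (X t ω, ξ t ω)) V) (n : ℕ) :
    ∫ ω, (∑ t ∈ Finset.range n, centered ν f (X t ω, ξ t ω)) * centered ν f (X n ω, ξ n ω) ∂P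
      = 0 := by
  have := hX.isProbabilityMeasure_input
  have hS := hX.withSum (measurable_centered (ν := ν) hf)
  have h_sum : MemLp (fun ω => ∑ t ∈ Finset.range n, centered ν f (X t ω, ξ t ω)) 2 P :=
    memLp_finsetSum _ fun t _ => (hX.secondMomentLE_centered hf (hV t)).1
  let f' : (α × ℝ) × γ → ℝ := fun p => f (p.1.1, p.2)
  have hf' : Measurable f' := by fun_prop
  refine (hS.integral_state_input (f := fun p => p.1.2 * centered ν f' p)
    ((measurable_snd.comp measurable_fst).mul (measurable_centered hf')) n).trans ?_
  exact integral_mul_centered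
    ((memLp_map_measure_iff measurable_snd.aestronglyMeasurable
      (hS.measurable_state n).aemeasurable).2 h_sum)
    ((hS.secondMomentLE_state_input_iff hf' n).1 (hV n)).1

theorem secondMomentLE_sum_centered [IsProbabilityMeasure P] (hf : Measurable f) {V : ℝ}
    (hV : ∀ t, SecondMomentLE P (fun ω => f (X t ω, ξ t ω)) V) (n : ℕ) :
    SecondMomentLE P (fun ω => ∑ t ∈ Finset.range n, centered ν f (X t ω, ξ t ω)) (n * V) := by
  have hM := fun t => hX.secondMomentLE_centered hf (hV t)
  have hS : ∀ n, MemLp (fun ω => ∑ t ∈ Finset.range n, centered ν f (X t ω, ξ t ω)) 2 P :=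
    fun n => memLp_finsetSum _ fun t _ => (hM t).1
  refine ⟨hS n, ?_⟩
  induction n with
  | zero => simp
  | succ n ih =>
    have h_cross : Integrable (fun ω => 2 * ((∑ t ∈ Finset.range n,
        centered ν f (X t ω, ξ t ω)) * centered ν f (X n ω, ξ n ω))) P :=
      ((hS n).integrable_mul (hM n).1).const_mul 2
    simp only [Finset.sum_range_succ, add_sq, mul_assoc]
    rw [integral_add (by exact (hS n).integrable_sq.add h_cross) (hM n).1.integrable_sq,
      integral_add (hS n).integrable_sq h_cross, integral_const_mul,
      hX.integral_sum_mul_centered hf hV, mul_zero, add_zero, Nat.cast_succ, add_mul, one_mul]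
    exact add_le_add ih (hM n).2

end IsDrivenBy

end DrivenSequence

section SampleMean

variable {Ω α γ : Type*} [MeasurableSpace Ω] [MeasurableSpace α] [MeasurableSpace γ]
  {P : Measure Ω}

namespace IsDrivenBy

variable {ν : Measure γ} {u : α × γ → α} {X : ℕ → Ω → α} {ξ : ℕ → Ω → γ} {ψ G : α → ℝ}
  {D : α × γ → ℝ} {h c K : ℝ} (hX : IsDrivenBy P ν u X ξ)

include hX

theorem mul_sum_eq (ψ G : α → ℝ) (h : ℝ) (n : ℕ) (ω : Ω) :
    h * ∑ t ∈ Finset.range n, G (X t ω)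
      = ψ (X n ω) - ψ (X 0 ω)
        - ∑ t ∈ Finset.range n, centered ν (fun p => ψ (u p) - ψ p.1) (X t ω, ξ t ω)
        - ∑ t ∈ Finset.range n, (∫ y, (ψ (u (X t ω, y)) - ψ (X t ω)) ∂ν - h * G (X t ω)) := by
  rw [← Finset.sum_range_sub (fun t => ψ (X t ω)), Finset.mul_sum, ← Finset.sum_sub_distrib,
    ← Finset.sum_sub_distrib]
  refine Finset.sum_congr rfl fun t _ => ?_
  simp only [centered, hX.succ]
  ring

theorem secondMomentLE_mul_sum [IsProbabilityMeasure P] (hψ : Measurable ψ) (hG : Measurable G)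
    (hD : Measurable D) (hh : 0 ≤ h)
    (hψK : ∀ t, SecondMomentLE P (fun ω => ψ (X t ω)) K)
    (hDK : ∀ t, SecondMomentLE P (fun ω => D (X t ω, ξ t ω)) K)
    (h_incr : ∀ p, |ψ (u p) - ψ p.1| ≤ c * √h * D p)
    (h_bias : ∀ x, Integrable (fun y => D (x, y)) ν →
      |∫ y, (ψ (u (x, y)) - ψ x) ∂ν - h * G x| ≤ c * h ^ 2 * ∫ y, D (x, y) ∂ν) (n : ℕ) :
    SecondMomentLE P (fun ω => h * ∑ t ∈ Finset.range n, G (X t ω))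
      (2 * (2 * (4 * K + n * (c ^ 2 * h * K)) + n ^ 2 * (c ^ 2 * h ^ 4 * K))) := by
  have := hX.isProbabilityMeasure_input
  have hu := hX.measurable_update
  have h_meas : Measurable fun p : α × γ => ψ (u p) - ψ p.1 := by fun_prop
  have h_boundary := (hψK n).sub (hψK 0)
  have h_martingale := hX.secondMomentLE_sum_centered h_meas (fun t => (hDK t).of_abs_le
    (h_meas.comp (hX.measurable_state_input t)) (.of_forall fun ω => h_incr (X t ω, ξ t ω))) n
  have h_remainder := SecondMomentLE.sum (Finset.range n) fun t _ =>
    (hX.secondMomentLE_integral_right hD (hDK t)).of_abs_le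
      (((measurable_integral_right h_meas).sub (hG.const_mul h)).comp (hX.measurable_state t))
      ((hX.ae_integrable_state hD (hDK t)).mono fun ω => h_bias (X t ω))
  simp only [hX.mul_sum_eq ψ G h n]
  refine ((h_boundary.sub h_martingale).sub h_remainder).mono (le_of_eq ?_)
  rw [Finset.card_range, mul_pow, Real.sq_sqrt hh]
  ring

theorem secondMomentLE_sampleMean_of_one_le [IsProbabilityMeasure P] (hψ : Measurable ψ)
    (hG : Measurable G) (hD : Measurable D) (hh : 0 < h) (hh1 : h ≤ 1) (hc : 1 ≤ c)
    (hψK : ∀ t, SecondMomentLE P (fun ω => ψ (X t ω)) K)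
    (hGK : ∀ t, SecondMomentLE P (fun ω => G (X t ω)) K)
    (hDK : ∀ t, SecondMomentLE P (fun ω => D (X t ω, ξ t ω)) K)
    (h_incr : ∀ p, |ψ (u p) - ψ p.1| ≤ c * √h * D p)
    (h_bias : ∀ x, Integrable (fun y => D (x, y)) ν →
      |∫ y, (ψ (u (x, y)) - ψ x) ∂ν - h * G x| ≤ c * h ^ 2 * ∫ y, D (x, y) ∂ν)
    {T : ℕ} (hT : 0 < T) (hhT : 1 ≤ h * T) :
    SecondMomentLE P (fun ω => (T : ℝ)⁻¹ * ∑ t ∈ Finset.Icc 1 T, G (X t ω))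
      (50 * c ^ 2 * K * (1 / (h * T) + h ^ 2)) := by
  have : (0 : ℝ) < T := Nat.cast_pos.2 hT
  have hK : 0 ≤ K := (hψK 0).nonneg
  have h_average : ∀ ω, (T : ℝ)⁻¹ * ∑ t ∈ Finset.Icc 1 T, G (X t ω)
      = (h * T)⁻¹ * (h * ∑ t ∈ Finset.range (T + 1), G (X t ω) - h * G (X 0 ω)) := fun ω => by
    rw [Finset.range_eq_Ico, Finset.sum_eq_sum_Ico_succ_bot (Nat.add_pos_right T one_pos),
      zero_add, Finset.Ico_add_one_right_eq_Icc]
    field_simp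
    ring
  simp only [h_average]
  refine (((hX.secondMomentLE_mul_sum hψ hG hD hh.le hψK hDK h_incr h_bias (T + 1)).sub
    ((hGK 0).const_mul h)).const_mul (h * T)⁻¹).mono ?_
  rw [inv_pow, inv_mul_le_iff₀ (by positivity)]
  have hcK : K ≤ c ^ 2 * K := le_mul_of_one_le_left hK (one_le_pow₀ hc)
  have hT2 : ((T + 1 : ℕ) : ℝ) ≤ 2 * T := by exact_mod_cast (by lia : T + 1 ≤ 2 * T)
  calc 2 * (2 * (2 * (4 * K + (T + 1 : ℕ) * (c ^ 2 * h * K))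
          + (T + 1 : ℕ) ^ 2 * (c ^ 2 * h ^ 4 * K)) + h ^ 2 * K)
      ≤ 2 * (2 * (2 * (4 * (c ^ 2 * K) + 2 * T * (c ^ 2 * h * K))
          + (2 * T) ^ 2 * (c ^ 2 * h ^ 4 * K)) + 1 * (c ^ 2 * K)) := by
        gcongr
        exact pow_le_one₀ hh.le hh1
    _ = c ^ 2 * K * (34 + 16 * (h * T) + 16 * (h ^ 2 * (h * T) ^ 2)) := by ring
    _ ≤ c ^ 2 * K * (50 * (h * T) + 50 * (h ^ 2 * (h * T) ^ 2)) := by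
        gcongr ?_ * ?_
        nlinarith [sq_nonneg (h * (h * T))]
    _ = (h * T) ^ 2 * (50 * c ^ 2 * K * (1 / (h * T) + h ^ 2)) := by field_simp

theorem secondMomentLE_sampleMean [IsProbabilityMeasure P] (hψ : Measurable ψ)
    (hG : Measurable G) (hD : Measurable D) (hh : 0 < h) (hc : 1 ≤ c)
    (hψK : ∀ t, SecondMomentLE P (fun ω => ψ (X t ω)) K)
    (hGK : ∀ t, SecondMomentLE P (fun ω => G (X t ω)) K)
    (hDK : ∀ t, SecondMomentLE P (fun ω => D (X t ω, ξ t ω)) K)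
    (h_incr : h ≤ 1 → ∀ p, |ψ (u p) - ψ p.1| ≤ c * √h * D p)
    (h_bias : h ≤ 1 → ∀ x, Integrable (fun y => D (x, y)) ν →
      |∫ y, (ψ (u (x, y)) - ψ x) ∂ν - h * G x| ≤ c * h ^ 2 * ∫ y, D (x, y) ∂ν)
    {T : ℕ} (hT : 0 < T) :
    SecondMomentLE P (fun ω => (T : ℝ)⁻¹ * ∑ t ∈ Finset.Icc 1 T, G (X t ω))
      (50 * c ^ 2 * K * (1 / (h * T) + h ^ 2)) := by
  have : (0 : ℝ) < T := Nat.cast_pos.2 hT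
  have hK : 0 ≤ K := (hGK 0).nonneg
  by_cases h_large : 1 ≤ 1 / (h * T) + h ^ 2
  · refine ((SecondMomentLE.sum (Finset.Icc 1 T) fun t _ => hGK t).const_mul _).mono ?_
    rw [Nat.card_Icc, Nat.add_sub_cancel, inv_pow, inv_mul_cancel_left₀ (by positivity)]
    calc K ≤ 50 * c ^ 2 * K := le_mul_of_one_le_left hK (by nlinarith)
      _ ≤ 50 * c ^ 2 * K * (1 / (h * T) + h ^ 2) := le_mul_of_one_le_right (by positivity) h_large
  · have h_inv : 0 < 1 / (h * T) := by positivity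
    have hh1 : h ≤ 1 := by nlinarith
    have hhT : 1 ≤ h * T := ((div_lt_one (by positivity)).1 (by nlinarith)).le
    exact hX.secondMomentLE_sampleMean_of_one_le hψ hG hD hh hh1 hc hψK hGK hDK (h_incr hh1)
      (h_bias hh1) hT hhT

end IsDrivenBy

end SampleMean

section Chain

variable {d : ℕ} {β Ω : Type*} [MeasurableSpace β] [MeasurableSpace Ω] {P : Measure Ω} {w : β → ℝ}
  {θ₀ : Ω → Param d} {B : ℕ → Ω → β} {Z : ℕ → Ω → Param d} {v : β → Param d → Param d}
  {W ψ : Param d → ℝ} {A κ a q h K : ℝ}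

theorem measurePreserving_neg_noise (π : Measure β) [SFinite π] :
    MeasurePreserving (fun ξ : β × Param d => (ξ.1, -ξ.2)) (π.prod (stdGaussian (Param d)))
      (π.prod (stdGaussian (Param d))) :=
  (MeasurePreserving.id π).prod ⟨measurable_neg, map_neg_stdGaussian⟩

namespace GrowthBounds

variable (hW : GrowthBounds W ψ v A κ a q)

include hW

theorem abs_driftGenerator_integral_le (π : Measure β) [IsProbabilityMeasure π] (θ : Param d) :
    |driftGenerator (fun θ => ∫ b, v b θ ∂π) ψ θ| ≤ A ^ 2 * W θ ^ (a + 2 * q) := by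
  have hA := hW.one_le_A
  have hWθ := hW.pos θ
  have h_drift : ‖∫ b, v b θ ∂π‖ ≤ A * W θ ^ q := by
    simpa using norm_integral_le_of_norm_le_const (ae_of_all π fun b => hW.norm_drift_le b θ)
  have h_first : |fderiv ℝ ψ θ (∫ b, v b θ ∂π)| ≤ A * W θ ^ a * (A * W θ ^ q) :=
    (fderiv ℝ ψ θ).le_of_opNorm_le_of_le (hW.norm_fderiv_le θ) h_drift
  have h_rpow_add : W θ ^ a * W θ ^ q ≤ W θ ^ (a + 2 * q) := by
    rw [← Real.rpow_add hWθ]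
    exact Real.rpow_le_rpow_of_exponent_le (hW.one_le θ) (by linarith [hW.q_pos])
  have h_rpow : W θ ^ a ≤ W θ ^ (a + 2 * q) :=
    Real.rpow_le_rpow_of_exponent_le (hW.one_le θ) (by linarith [hW.q_pos])
  calc |driftGenerator (fun θ => ∫ b, v b θ ∂π) ψ θ|
      ≤ 1 / 2 * (A * W θ ^ a * (A * W θ ^ q) + A * W θ ^ a) := by
        rw [driftGenerator, abs_mul, abs_of_pos one_half_pos]
        gcongr
        exact (abs_add_le _ _).trans (add_le_add h_first (hW.abs_laplacian_le θ))
    _ = 1 / 2 * (A ^ 2 * (W θ ^ a * W θ ^ q) + A * W θ ^ a) := by ring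
    _ ≤ 1 / 2 * (A ^ 2 * W θ ^ (a + 2 * q) + A ^ 2 * W θ ^ (a + 2 * q)) := by
        gcongr
        exact le_self_pow₀ hA two_ne_zero
    _ = A ^ 2 * W θ ^ (a + 2 * q) := by ring

theorem secondMomentLE_norm_rpow_noise (hN : IsDrivingNoise P w θ₀ B Z) (t : ℕ) :
    SecondMomentLE P (fun ω => ‖Z t ω‖ ^ ((a + 2 * q) / q))
      (∫ z, (‖z‖ ^ ((a + 2 * q) / q)) ^ 2 ∂stdGaussian (Param d)) := by
  have ha := hW.a_pos
  have hq := hW.q_pos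
  rw [← SecondMomentLE.map_iff (g := fun z : Param d => ‖z‖ ^ ((a + 2 * q) / q))
    (hN.measurable_noise t) (by fun_prop), hN.noise_law]
  exact ⟨memLp_norm_rpow_stdGaussian (by positivity) 2, le_rfl⟩

end GrowthBounds

variable [Countable β] [MeasurableSingletonClass β]

namespace IsDrivingNoise

variable [IsProbabilityMeasure P] (hN : IsDrivingNoise P w θ₀ B Z)

include hN

theorem map_batch (t : ℕ) : P.map (B t) = P.map (B 0) := by
  refine Measure.ext_of_singleton fun b => ?_
  rw [Measure.map_apply (hN.measurable_batch t) (measurableSet_singleton b),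
    Measure.map_apply (hN.measurable_batch 0) (measurableSet_singleton b),
    ← measureReal_eq_measureReal_iff, hN.batch_law, hN.batch_law]

theorem isDrivenBy_chain (hv : ∀ b, Continuous (v b)) (h : ℝ) :
    IsDrivenBy P ((P.map (B 0)).prod (stdGaussian (Param d))) (fun p => step v h p.1 p.2)
      (chain v θ₀ B Z h) (fun t ω => (B t ω, Z t ω)) where
  measurable_update := measurable_step hv h
  measurable_init := hN.measurable_init
  measurable_input t := (hN.measurable_batch t).prodMk (hN.measurable_noise t)
  succ _ _ := rfl
  map_input t := by
    rw [(indepFun_iff_map_prod_eq_prod_map_map (hN.measurable_batch t).aemeasurable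
      (hN.measurable_noise t).aemeasurable).1 (hN.indep_batch_noise t), hN.map_batch,
      hN.noise_law]
  iIndepFun_input := hN.indep_time
  indepFun_init := hN.indep_init

end IsDrivingNoise

namespace GrowthBounds

variable [IsProbabilityMeasure P] (hW : GrowthBounds W ψ v A κ a q)
  (hN : IsDrivingNoise P w θ₀ B Z)

include hW hN

theorem secondMomentLE_rpow_chain {t : ℕ}
    (h_int : Integrable (fun ω => W (chain v θ₀ B Z h t ω) ^ (2 * a + 4 * q)) P)
    (h_le : ∫ ω, W (chain v θ₀ B Z h t ω) ^ (2 * a + 4 * q) ∂P ≤ K) :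
    SecondMomentLE P (fun ω => W (chain v θ₀ B Z h t ω) ^ (a + 2 * q)) K := by
  refine .of_sq_le h_int h_le ((hW.measurable.comp
    ((hN.isDrivenBy_chain hW.continuous_drift h).measurable_state t)).pow_const _) fun ω => ?_
  rw [← Real.rpow_mul_natCast (hW.pos _).le]
  exact le_of_eq (by congr 1; push_cast; ring)

theorem secondMomentLE_dominator_chain
    (hK : ∀ t, SecondMomentLE P (fun ω => W (chain v θ₀ B Z h t ω) ^ (a + 2 * q)) K) (t : ℕ) :
    SecondMomentLE P (fun ω => dominator W v a q h (chain v θ₀ B Z h t ω) (B t ω, Z t ω))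
      (2 * ((∫ z, (‖z‖ ^ ((a + 2 * q) / q)) ^ 2 ∂stdGaussian (Param d)) + 10 * K)) := by
  have hX := hN.isDrivenBy_chain hW.continuous_drift h
  have := Measure.isProbabilityMeasure_map (μ := P) (hN.measurable_batch 0).aemeasurable
  have h_step : SecondMomentLE P (fun ω => W (step v h (chain v θ₀ B Z h t ω)
      (B t ω, Z t ω)) ^ (a + 2 * q)) K := hK (t + 1)
  have h_reflected := hX.secondMomentLE_comp_input (t := t)
    (f := fun x => W (step v h x.1 x.2) ^ (a + 2 * q))
    ((hW.measurable_apply_step h).pow_const (a + 2 * q)) (measurePreserving_neg_noise _) h_step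
  exact ((hW.secondMomentLE_norm_rpow_noise hN t).add
    ((hK t).add (h_step.add h_reflected))).mono (le_of_eq (by ring))

theorem secondMomentLE_sampleAverage (hh : 0 < h)
    (hK : ∀ t, Integrable (fun ω => W (chain v θ₀ B Z h t ω) ^ (2 * a + 4 * q)) P ∧
      ∫ ω, W (chain v θ₀ B Z h t ω) ^ (2 * a + 4 * q) ∂P ≤ K) {T : ℕ} (hT : 0 < T) :
    SecondMomentLE P
      (sampleAverage (driftGenerator (fun θ => ∫ b, v b θ ∂(P.map (B 0))) ψ) (chain v θ₀ B Z h) T)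
      (50 * (3 * growthConst A κ a ^ 3) ^ 2 * (A ^ 4 * (2 * ((∫ z, (‖z‖ ^ ((a + 2 * q) / q)) ^ 2
        ∂stdGaussian (Param d)) + 10 * K))) * (1 / (h * T) + h ^ 2)) := by
  have hX := hN.isDrivenBy_chain hW.continuous_drift h
  have := Measure.isProbabilityMeasure_map (μ := P) (hN.measurable_batch 0).aemeasurable
  have hA := hW.one_le_A
  have hL := hW.one_le_growthConst
  have hWK := fun t => hW.secondMomentLE_rpow_chain hN (hK t).1 (hK t).2
  have hK0 : 0 ≤ K := (hWK 0).nonneg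
  have hψ_meas := hW.contDiff.continuous.measurable
  have hG_meas := hW.measurable_driftGenerator_integral (π := P.map (B 0))
  have hL23 : 2 * growthConst A κ a ^ 2 ≤ 3 * growthConst A κ a ^ 3 :=
    mul_le_mul (by norm_num) (pow_le_pow_right₀ hL (by norm_num)) (by positivity) (by norm_num)
  set J := ∫ z, (‖z‖ ^ ((a + 2 * q) / q)) ^ 2 ∂stdGaussian (Param d)
  have hJ : 0 ≤ J := integral_nonneg fun z => sq_nonneg _
  refine hX.secondMomentLE_sampleMean (D := fun x => dominator W v a q h x.1 x.2) hψ_meas hG_meas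
    (hW.measurable_dominator h) hh (by nlinarith [one_le_pow₀ hL (n := 3)]) (fun t => ?_)
    (fun t => ?_) (fun t => ?_) (fun hh1 x => ?_) (fun hh1 θ hD => ?_) hT
  · refine ((hWK t).of_abs_le (hψ_meas.comp (hX.measurable_state t))
      (c := A) (ae_of_all _ fun ω => (hW.abs_sol_le _).trans ?_)).mono ?_
    · gcongr
      · exact hW.one_le _
      · linarith [hW.q_pos]
    · gcongr
      · norm_num
      · linarith
  · refine ((hWK t).of_abs_le (hG_meas.comp (hX.measurable_state t))
      (ae_of_all _ fun ω => hW.abs_driftGenerator_integral_le _ _)).mono ?_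
    rw [← pow_mul]
    gcongr
    linarith
  · refine (hW.secondMomentLE_dominator_chain hN hWK t).mono ?_
    exact le_mul_of_one_le_left (by positivity) (one_le_pow₀ hA)
  · refine (hW.abs_sol_step_sub_le hh hh1).trans ?_
    gcongr
    exact hW.dominator_nonneg
  · exact hW.abs_integral_step_sub_le hh hh1 hD

theorem exists_secondMomentLE_sampleAverage {H : Set ℝ} (hH : ∀ h ∈ H, 0 < h)
    (hK : ∀ h ∈ H, ∀ t, Integrable (fun ω => W (chain v θ₀ B Z h t ω) ^ (2 * a + 4 * q)) P ∧
      ∫ ω, W (chain v θ₀ B Z h t ω) ^ (2 * a + 4 * q) ∂P ≤ K) :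
    ∃ C : ℝ, 0 < C ∧ ∀ h ∈ H, ∀ T : ℕ, 0 < T → SecondMomentLE P
      (sampleAverage (driftGenerator (fun θ => ∫ b, v b θ ∂(P.map (B 0))) ψ) (chain v θ₀ B Z h) T)
      (C * (1 / (h * T) + h ^ 2)) := by
  refine ⟨max _ 1, lt_max_of_lt_right one_pos, fun h hh T hT =>
    (hW.secondMomentLE_sampleAverage hN (hH h hh) (hK h hh) hT).mono
      (mul_le_mul_of_nonneg_right (le_max_left _ _) ?_)⟩
  have h_pos := hH h hh
  positivity

end GrowthBounds

end Chain

section Posterior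

instance instMeasurableSingletonClassSigma {ι : Type*} {α : ι → Type*}
    [∀ i, MeasurableSpace (α i)] [∀ i, MeasurableSingletonClass (α i)] :
    MeasurableSingletonClass (Sigma α) where
  measurableSet_singleton x := by
    rw [MeasurableSpace.measurableSet_iInf]
    exact fun i => (Set.subsingleton_singleton.preimage sigma_mk_injective).measurableSet

theorem sum_uniform_smul_sum {ι F : Type*} [Fintype ι] [Nonempty ι] [AddCommGroup F] [Module ℝ F]
    (m : ℕ) (g : ι → F) :
    ∑ b : Fin m → ι, (1 / (Fintype.card ι : ℝ)) ^ m • ∑ j, g (b j)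
      = ((m : ℝ) / Fintype.card ι) • ∑ i, g i := by
  have h_card : (Fintype.card ι : ℝ) ≠ 0 := Nat.cast_ne_zero.2 Fintype.card_ne_zero
  have h_single : ∀ j : Fin m, (1 / (Fintype.card ι : ℝ)) ^ m • ∑ b : Fin m → ι, g (b j)
      = (1 / (Fintype.card ι : ℝ)) • ∑ i, g i := by
    intro j
    obtain ⟨n, rfl⟩ := Nat.exists_eq_succ_of_ne_zero j.pos.ne'
    rw [← (Fin.insertNthEquiv (fun _ => ι) j).sum_comp, Fintype.sum_prod_type]
    simp only [Fin.insertNthEquiv_apply, Fin.insertNth_apply_same, Finset.sum_const,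
      Finset.card_univ, Fintype.card_pi, Finset.prod_const, Fintype.card_fin]
    rw [← Finset.smul_sum, ← Nat.cast_smul_eq_nsmul ℝ, smul_smul]
    congr 1
    push_cast
    rw [pow_succ, mul_right_comm, ← mul_pow, one_div_mul_cancel h_card, one_pow, one_mul]
  rw [← Finset.smul_sum, Finset.sum_comm, Finset.smul_sum,
    Finset.sum_congr rfl fun j _ => h_single j, Finset.sum_const, Finset.card_univ,
    Fintype.card_fin, ← Nat.cast_smul_eq_nsmul ℝ, smul_smul, mul_one_div]

theorem sum_uniform_smul_add_smul_sum {ι F : Type*} [Fintype ι] [Nonempty ι] [AddCommGroup F]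
    [Module ℝ F] (m : ℕ) (e : F) (c : ℝ) (g : ι → F) :
    ∑ b : Fin m → ι, (1 / (Fintype.card ι : ℝ)) ^ m • (e + c • ∑ j, g (b j))
      = e + (c * m / Fintype.card ι) • ∑ i, g i := by
  have h_card : (Fintype.card ι : ℝ) ≠ 0 := Nat.cast_ne_zero.2 Fintype.card_ne_zero
  have h_total : (Fintype.card (Fin m → ι) : ℝ) * (1 / (Fintype.card ι : ℝ)) ^ m = 1 := by
    rw [Fintype.card_pi_const, Nat.cast_pow, ← mul_pow, mul_one_div_cancel h_card, one_pow]
  simp only [smul_add, Finset.sum_add_distrib, smul_comm _ c]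
  rw [Finset.sum_const, Finset.card_univ, ← Nat.cast_smul_eq_nsmul ℝ, smul_smul, h_total, one_smul,
    ← Finset.smul_sum, sum_uniform_smul_sum, smul_smul, mul_div_assoc]

theorem contDiff_gradient {F : Type*} [NormedAddCommGroup F] [InnerProductSpace ℝ F]
    [CompleteSpace F] {f : F → ℝ} {n k : WithTop ℕ∞} (hf : ContDiff ℝ n f) (hk : k + 1 ≤ n) :
    ContDiff ℝ k (∇ f) :=
  (InnerProductSpace.toDual ℝ F).symm.contDiff.comp (hf.fderiv_right hk)

variable {d S : ℕ} {𝒳 : Type*} {M : Model d S 𝒳}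

namespace Model

/-- A family of gradient estimators `v b`, used with the probabilities `w b`, that is unbiased for
the gradient of the log-posterior. -/
structure IsUnbiasedEstimator {β : Type*} (M : Model d S 𝒳) (w : β → ℝ)
    (v : β → Param d → Param d) : Prop where
  continuous : ∀ b, Continuous (v b)
  hasSum : ∀ θ, HasSum (fun b => w b • v b θ) (∇ (fun θ' => Real.log (M.posterior θ')) θ)

namespace IsRegular

variable (hM : M.IsRegular)

include hM

theorem unnormalized_pos (θ : Param d) : 0 < M.unnormalized θ :=
  mul_pos (hM.prior_pos θ) (Finset.prod_pos fun s _ => Finset.prod_pos fun i _ => hM.lik_pos s i θ)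

theorem integral_unnormalized_pos : 0 < ∫ θ, M.unnormalized θ := by
  rw [integral_pos_iff_support_of_nonneg (fun θ => (hM.unnormalized_pos θ).le) hM.proper,
    (Set.eq_univ_of_forall fun θ => (hM.unnormalized_pos θ).ne' :
      Function.support M.unnormalized = Set.univ)]
  exact Measure.measure_univ_pos.2 (NeZero.ne _)

theorem log_posterior (θ : Param d) :
    Real.log (M.posterior θ) = Real.log (M.prior θ)
      + ∑ s, ∑ i, Real.log (M.lik (M.x s i) θ) - Real.log (∫ θ', M.unnormalized θ') := by
  have h_shard : ∀ s, ∏ i, M.lik (M.x s i) θ ≠ 0 := fun s =>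
    Finset.prod_ne_zero_iff.2 fun i _ => (hM.lik_pos s i θ).ne'
  rw [posterior, Real.log_div (hM.unnormalized_pos θ).ne' hM.integral_unnormalized_pos.ne',
    unnormalized, Real.log_mul (hM.prior_pos θ).ne'
      (Finset.prod_ne_zero_iff.2 fun s _ => h_shard s),
    Real.log_prod fun s _ => h_shard s]
  simp only [Real.log_prod fun i _ => (hM.lik_pos _ i θ).ne']

theorem contDiff_log_prior : ContDiff ℝ 3 fun θ => Real.log (M.prior θ) :=
  hM.prior_contDiff.log fun θ => (hM.prior_pos θ).ne'

theorem contDiff_log_lik (s : Fin S) (i : Fin (M.N s)) :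
    ContDiff ℝ 3 fun θ => Real.log (M.lik (M.x s i) θ) :=
  (hM.lik_contDiff s i).log fun θ => (hM.lik_pos s i θ).ne'

theorem contDiff_log_posterior : ContDiff ℝ 3 fun θ => Real.log (M.posterior θ) := by
  simp_rw [hM.log_posterior]
  exact (hM.contDiff_log_prior.add (ContDiff.sum fun s _ => ContDiff.sum fun i _ =>
    hM.contDiff_log_lik s i)).sub contDiff_const

theorem gradient_log_posterior (θ : Param d) :
    ∇ (fun θ' => Real.log (M.posterior θ')) θ
      = ∇ (fun θ' => Real.log (M.prior θ')) θ + ∑ s, ∑ i, M.gradLogLik (M.x s i) θ := by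
  have h_lik : ∀ s i, DifferentiableAt ℝ (fun θ' => Real.log (M.lik (M.x s i) θ')) θ :=
    fun s i => (hM.contDiff_log_lik s i).differentiable three_ne_zero θ
  have h_shard : ∀ s, DifferentiableAt ℝ (fun θ' => ∑ i, Real.log (M.lik (M.x s i) θ')) θ :=
    fun s => .fun_sum fun i _ => h_lik s i
  simp only [gradient, gradLogLik, hM.log_posterior]
  rw [fderiv_sub_const, fderiv_fun_add (hM.contDiff_log_prior.differentiable three_ne_zero θ)
    (.fun_sum fun s _ => h_shard s), fderiv_fun_sum fun s _ => h_shard s]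
  simp only [fderiv_fun_sum fun i _ => h_lik _ i, map_add, map_sum]

theorem continuous_grad_log_prior : Continuous (∇ fun θ => Real.log (M.prior θ)) :=
  (contDiff_gradient (k := 0) hM.contDiff_log_prior (by norm_num)).continuous

theorem continuous_gradLogLik (s : Fin S) (i : Fin (M.N s)) :
    Continuous (M.gradLogLik (M.x s i)) :=
  (contDiff_gradient (k := 0) (hM.contDiff_log_lik s i) (by norm_num)).continuous

theorem isUnbiasedEstimator_dsgldEstimator {f : Fin S → ℝ} (hf_pos : ∀ s, 0 < f s)
    (hf_sum : ∑ s, f s = 1) {m : ℕ} (hm : 0 < m) :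
    M.IsUnbiasedEstimator (M.shardBatchProb f m) (M.dsgldEstimator f m) where
  continuous _ := hM.continuous_grad_log_prior.add
    ((continuous_finsetSum _ fun _ _ => hM.continuous_gradLogLik _ _).fun_const_smul _)
  hasSum θ := by
    have h_shard : ∀ s, ∑ c : Fin m → Fin (M.N s),
        M.shardBatchProb f m ⟨s, c⟩ • M.dsgldEstimator f m ⟨s, c⟩ θ
        = f s • ∇ (fun θ' => Real.log (M.prior θ')) θ + ∑ i, M.gradLogLik (M.x s i) θ := by
      intro s
      have : NeZero (M.N s) := ⟨(hM.shard_nonempty s).ne'⟩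
      have h_ne : (M.N s : ℝ) ≠ 0 := NeZero.ne _
      have hf := (hf_pos s).ne'
      have h_avg := sum_uniform_smul_add_smul_sum m (∇ (fun θ' => Real.log (M.prior θ')) θ)
        ((M.N s : ℝ) / (f s * m)) fun i => M.gradLogLik (M.x s i) θ
      rw [Fintype.card_fin] at h_avg
      simp only [shardBatchProb, dsgldEstimator, mul_smul]
      rw [← Finset.smul_sum, h_avg, smul_add, smul_smul,
        show f s * (M.N s / (f s * m) * m / M.N s) = 1 by field_simp, one_smul]
    convert hasSum_fintype _ using 1
    rw [hM.gradient_log_posterior, Fintype.sum_sigma, Finset.sum_congr rfl fun s _ => h_shard s,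
      Finset.sum_add_distrib, ← Finset.sum_smul, hf_sum, one_smul]

theorem isUnbiasedEstimator_sgldEstimator (hS : 0 < S) {m : ℕ} (hm : 0 < m) :
    M.IsUnbiasedEstimator (M.mergedBatchProb m) (M.sgldEstimator m) where
  continuous _ := hM.continuous_grad_log_prior.add
    ((continuous_finsetSum _ fun _ _ => hM.continuous_gradLogLik _ _).fun_const_smul _)
  hasSum θ := by
    have : Nonempty ((s : Fin S) × Fin (M.N s)) := ⟨⟨⟨0, hS⟩, ⟨0, hM.shard_nonempty _⟩⟩⟩
    have h_card : Fintype.card ((s : Fin S) × Fin (M.N s)) = M.total := by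
      simp [total, Fintype.card_sigma]
    have h_total : (M.total : ℝ) ≠ 0 := h_card ▸ Nat.cast_ne_zero.2 Fintype.card_ne_zero
    have h_avg := sum_uniform_smul_add_smul_sum m (∇ (fun θ' => Real.log (M.prior θ')) θ)
      ((M.total : ℝ) / m) fun i : (s : Fin S) × Fin (M.N s) => M.gradLogLik (M.x i.1 i.2) θ
    rw [h_card, Fintype.sum_sigma, show (M.total : ℝ) / m * m / M.total = 1 by field_simp,
      one_smul, ← hM.gradient_log_posterior] at h_avg
    exact h_avg ▸ hasSum_fintype _

theorem norm_estimator_sub_grad_log_posterior_le {γ : Fin S → ℝ}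
    (hγ : ∀ s i θ, ‖M.gradLogLik (M.x s i) θ‖ ≤ γ s) {m : ℕ} (c : ℝ)
    (b : Fin m → (s : Fin S) × Fin (M.N s)) (θ : Param d) :
    ‖∇ (fun θ' => Real.log (M.prior θ')) θ + c • ∑ j, M.gradLogLik (M.x (b j).1 (b j).2) θ
        - ∇ (fun θ' => Real.log (M.posterior θ')) θ‖
      ≤ |c| * ∑ j, γ (b j).1 + ∑ s, M.N s * γ s := by
  rw [hM.gradient_log_posterior, add_sub_add_left_eq_sub]
  refine (norm_sub_le _ _).trans (add_le_add ?_ ?_)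
  · rw [norm_smul, Real.norm_eq_abs]
    exact mul_le_mul_of_nonneg_left (norm_sum_le_of_le _ fun j _ => hγ _ _ θ) (abs_nonneg c)
  · refine norm_sum_le_of_le _ fun s _ => ?_
    simpa using norm_sum_le_of_le Finset.univ fun i _ => hγ s i θ

end IsRegular

end Model

end Posterior

section Derivatives

variable {E : Type*} [NormedAddCommGroup E]

theorem norm_fderiv_fderiv {F : Type*} [NormedSpace ℝ E] [NormedAddCommGroup F] [NormedSpace ℝ F]
    (f : E → F) (x : E) : ‖fderiv ℝ (fderiv ℝ f) x‖ = ‖iteratedFDeriv ℝ 2 f x‖ := by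
  rw [← norm_iteratedFDeriv_one, norm_iteratedFDeriv_fderiv]

variable [InnerProductSpace ℝ E]

theorem norm_iteratedFDeriv_gradient [CompleteSpace E] (f : E → ℝ) (x : E) (n : ℕ) :
    ‖iteratedFDeriv ℝ n (∇ f) x‖ = ‖iteratedFDeriv ℝ (n + 1) f x‖ := by
  rw [← norm_iteratedFDeriv_fderiv]
  exact (InnerProductSpace.toDual ℝ E).symm.norm_iteratedFDeriv_comp_left (fderiv ℝ f) x n

theorem norm_iteratedFDeriv_two_inner_gradient_le [CompleteSpace E] {f g : E → ℝ}
    (hf : ContDiff ℝ 3 f) (hg : ContDiff ℝ 3 g) (x : E) :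
    ‖iteratedFDeriv ℝ 2 (fun y => inner ℝ (∇ f y) (∇ g y)) x‖
      ≤ ‖iteratedFDeriv ℝ 1 f x‖ * ‖iteratedFDeriv ℝ 3 g x‖
        + 2 * ‖iteratedFDeriv ℝ 2 f x‖ * ‖iteratedFDeriv ℝ 2 g x‖
        + ‖iteratedFDeriv ℝ 3 f x‖ * ‖iteratedFDeriv ℝ 1 g x‖ := by
  have h_leibniz := (innerSL ℝ (E := E)).norm_iteratedFDeriv_le_of_bilinear_of_le_one
    (contDiff_gradient hf (by norm_num)) (contDiff_gradient hg (by norm_num)) x (n := 2) le_rfl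
    (norm_innerSL_le ℝ)
  refine h_leibniz.trans_eq ?_
  simp [Finset.sum_range_succ, norm_iteratedFDeriv_gradient, -norm_iteratedFDeriv_zero]

variable [FiniteDimensional ℝ E]

theorem abs_laplacian_le (ψ : E → ℝ) (θ : E) :
    |Δ ψ θ| ≤ Module.finrank ℝ E * ‖iteratedFDeriv ℝ 2 ψ θ‖ := by
  rw [InnerProductSpace.laplacian_eq_iteratedFDeriv_stdOrthonormalBasis]
  refine (Finset.abs_sum_le_sum_abs _ _).trans ((Finset.sum_le_card_nsmul _ _
    ‖iteratedFDeriv ℝ 2 ψ θ‖ fun i _ => ?_).trans_eq (by simp))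
  exact ((iteratedFDeriv ℝ 2 ψ θ).le_opNorm _).trans_eq (by simp)

theorem norm_fderiv_laplacian_le {ψ : E → ℝ} (hψ : ContDiff ℝ 3 ψ) (θ : E) :
    ‖fderiv ℝ (Δ ψ) θ‖ ≤ Module.finrank ℝ E * ‖iteratedFDeriv ℝ 3 ψ θ‖ := by
  set b := stdOrthonormalBasis ℝ E
  have h_deriv : HasFDerivAt (iteratedFDeriv ℝ 2 ψ) (fderiv ℝ (iteratedFDeriv ℝ 2 ψ) θ) θ :=
    (hψ.differentiable_iteratedFDeriv (m := 2) (by norm_num) θ).hasFDerivAt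
  have h_sum := HasFDerivAt.fun_sum (u := Finset.univ) fun i _ =>
    (ContinuousMultilinearMap.apply ℝ (fun _ : Fin 2 => E) ℝ ![b i, b i]).hasFDerivAt.comp θ h_deriv
  have h_third : ∀ w, ‖fderiv ℝ (iteratedFDeriv ℝ 2 ψ) θ w‖ ≤ ‖iteratedFDeriv ℝ 3 ψ θ‖ * ‖w‖ := by
    intro w
    rw [← norm_fderiv_iteratedFDeriv]
    exact ContinuousLinearMap.le_opNorm _ w
  rw [InnerProductSpace.laplacian_eq_iteratedFDeriv_stdOrthonormalBasis]
  refine h_sum.fderiv ▸ ContinuousLinearMap.opNorm_le_bound _ (by positivity) fun w => ?_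
  rw [_root_.sum_apply]
  refine (norm_sum_le_of_le (f := fun i => (fderiv ℝ (iteratedFDeriv ℝ 2 ψ) θ w) ![b i, b i])
    Finset.univ fun i _ => ?_).trans_eq (b := ∑ _i, ‖iteratedFDeriv ℝ 3 ψ θ‖ * ‖w‖) ?_
  · exact ((fderiv ℝ (iteratedFDeriv ℝ 2 ψ) θ w).le_opNorm _).trans
      (le_trans (le_of_eq (by simp)) (h_third w))
  · simp [mul_assoc]

end Derivatives

section Growth

open Asymptotics Filter

theorem eventually_norm_le_mul_of_isBigO {α F : Type*} [Norm F] {f : α → F}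
    {g : α → ℝ} (hg : ∀ x, 0 ≤ g x) (h : f =O[⊤] g) : ∀ᶠ A in atTop, ∀ x, ‖f x‖ ≤ A * g x := by
  simpa only [eventually_top, Real.norm_of_nonneg (hg _)] using isBigO_iff_eventually.1 h

variable {α : Type*} {Γ : α → ℝ} (hΓ : ∀ x, 0 ≤ Γ x)

include hΓ

theorem isBigO_rpow_one_add_rpow {s t : ℝ} (hs : 0 ≤ s) (hst : s ≤ t) :
    (fun x => Γ x ^ s) =O[⊤] fun x => (1 + Γ x) ^ t := by
  refine isBigO_of_le _ fun x => ?_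
  have hx := hΓ x
  rw [Real.norm_of_nonneg (by positivity), Real.norm_of_nonneg (by positivity)]
  exact (Real.rpow_le_rpow hx (by linarith) hs).trans
    (Real.rpow_le_rpow_of_exponent_le (by linarith) hst)

theorem isBigO_one_add_rpow_one_add_rpow {s t : ℝ} (hs : 0 ≤ s) (hst : s ≤ t) :
    (fun x => 1 + Γ x ^ s) =O[⊤] fun x => (1 + Γ x) ^ t := by
  have h_one := isBigO_rpow_one_add_rpow hΓ le_rfl (hs.trans hst)
  simp only [Real.rpow_zero] at h_one
  exact h_one.add (isBigO_rpow_one_add_rpow hΓ hs hst)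

omit hΓ

theorem one_add_le_mul_max_of_rpow_le {x y z C R : ℝ} (hx : 0 ≤ x) (hy : 0 ≤ y) (hz : 0 ≤ z)
    (hR : 0 < R) (h : z ^ R ≤ C * (x ^ R + y ^ R)) :
    1 + z ≤ (1 + (2 * |C|) ^ (1 / R)) * max (1 + x) (1 + y) := by
  set k := (2 * |C|) ^ (1 / R) with hk
  set M := max (1 + x) (1 + y)
  have hxM : 1 + x ≤ M := le_max_left _ _
  have hyM : 1 + y ≤ M := le_max_right _ _
  have hM : 0 ≤ M := by linarith
  have h_pow : z ^ R ≤ (k * M) ^ R := calc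
    z ^ R ≤ |C| * (x ^ R + y ^ R) :=
      h.trans (mul_le_mul_of_nonneg_right (le_abs_self C) (by positivity))
    _ ≤ |C| * (M ^ R + M ^ R) := by gcongr <;> linarith
    _ = (k * M) ^ R := by
      rw [Real.mul_rpow (by positivity) hM, hk, ← Real.rpow_mul (by positivity),
        one_div_mul_cancel hR.ne', Real.rpow_one]
      ring
  have hzM : z ≤ k * M := (Real.rpow_le_rpow_iff hz (by positivity) hR).1 h_pow
  linarith

theorem one_add_le_mul_max_of_segment {F : Type*} [AddCommGroup F] [Module ℝ F] {Γ : F → ℝ}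
    (hΓ : ∀ θ, 0 ≤ Γ θ) {C R : ℝ} (hR : 0 < R)
    (hC : ∀ θ θ' : F, ∀ a ∈ Set.Ioo (0 : ℝ) 1,
      Γ (a • θ + (1 - a) • θ') ^ R ≤ C * (Γ θ ^ R + Γ θ' ^ R))
    (θ u : F) {c : ℝ} (hc : c ∈ Set.Icc (0 : ℝ) 1) :
    1 + Γ (θ + c • u) ≤ (1 + (2 * |C|) ^ (1 / R)) * max (1 + Γ θ) (1 + Γ (θ + u)) := by
  have hθ := hΓ θ
  have hu := hΓ (θ + u)
  have h_max : max (1 + Γ θ) (1 + Γ (θ + u))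
      ≤ (1 + (2 * |C|) ^ (1 / R)) * max (1 + Γ θ) (1 + Γ (θ + u)) :=
    le_mul_of_one_le_left (by positivity) (le_add_of_nonneg_right (by positivity))
  rcases hc.1.eq_or_lt with rfl | hc0
  · rw [zero_smul, add_zero] at *
    exact (le_max_left _ _).trans h_max
  rcases hc.2.eq_or_lt with rfl | hc1
  · rw [one_smul] at *
    exact (le_max_right _ _).trans h_max
  have h_seg := hC (θ + u) θ c ⟨hc0, hc1⟩
  rw [show c • (θ + u) + (1 - c) • θ = θ + c • u by module, add_comm (Γ (θ + u) ^ R)] at h_seg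
  exact one_add_le_mul_max_of_rpow_le hθ hu (hΓ _) hR h_seg

theorem one_add_rpow_le {x s : ℝ} (hx : 0 ≤ x) (hs : 0 ≤ s) :
    (1 + x) ^ s ≤ 2 ^ s * (1 + x ^ s) := by
  have h_max : (1 + x) ^ s ≤ 2 ^ s * max 1 x ^ s := by
    rw [← Real.mul_rpow zero_le_two (by positivity)]
    exact Real.rpow_le_rpow (by positivity) (by linarith [le_max_left 1 x, le_max_right 1 x]) hs
  refine h_max.trans (mul_le_mul_of_nonneg_left ?_ (by positivity))
  rcases max_choice 1 x with h | h <;> rw [h]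
  · rw [Real.one_rpow]
    exact le_add_of_nonneg_right (by positivity)
  · exact le_add_of_nonneg_left zero_le_one

theorem integrable_one_add_rpow {Ω : Type*} [MeasurableSpace Ω] {P : Measure Ω}
    [IsProbabilityMeasure P] {g : Ω → ℝ} (hg : Measurable g) (hg0 : ∀ ω, 0 ≤ g ω) {R K : ℝ}
    (hR : 0 ≤ R) (hi : Integrable (fun ω => g ω ^ R) P) (hK : ∫ ω, g ω ^ R ∂P ≤ K) :
    Integrable (fun ω => (1 + g ω) ^ R) P ∧ ∫ ω, (1 + g ω) ^ R ∂P ≤ 2 ^ R * (1 + K) := by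
  have h_dom : Integrable (fun ω => 2 ^ R * (1 + g ω ^ R)) P :=
    ((integrable_const 1).add hi).const_mul _
  have h_int : Integrable (fun ω => (1 + g ω) ^ R) P := by
    refine h_dom.mono' ((hg.const_add 1).pow_const _).aestronglyMeasurable (ae_of_all _ fun ω => ?_)
    rw [Real.norm_of_nonneg (Real.rpow_nonneg (by linarith [hg0 ω]) _)]
    exact one_add_rpow_le (hg0 ω) hR
  refine ⟨h_int, (integral_mono h_int h_dom fun ω => one_add_rpow_le (hg0 ω) hR).trans ?_⟩
  rw [integral_const_mul, integral_add (integrable_const _) hi]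
  exact mul_le_mul_of_nonneg_left (by simpa using hK) (by positivity)

end Growth

section PoissonRegularity

open Asymptotics Filter

variable {d S : ℕ} {𝒳 : Type*} {M : Model d S 𝒳} {φ ψ Γ : Param d → ℝ} {p : Fin 4 → ℝ} {r q : ℝ}

namespace PoissonRegularity

variable (hreg : PoissonRegularity M φ ψ Γ p r q)

include hreg

theorem momentOrder_pos : 0 < momentOrder p r q := by
  have hr := hreg.r_pos
  have hq := hreg.q_pos
  have h_max := le_max_right (⨆ k, p k) r
  unfold momentOrder
  linarith

theorem laplacian_eq (θ : Param d) :
    Δ ψ θ = 2 * φ θ - inner ℝ (∇ (fun θ' => Real.log (M.posterior θ')) θ) (∇ ψ θ)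
      - 2 * M.posteriorMean φ := by
  have h_poisson := hreg.poisson θ
  unfold Model.generator at h_poisson
  linarith

theorem contDiff_inner_gradient (hM : M.IsRegular) :
    ContDiff ℝ 2 fun θ => inner ℝ (∇ (fun θ' => Real.log (M.posterior θ')) θ) (∇ ψ θ) :=
  (contDiff_gradient hM.contDiff_log_posterior (by norm_num)).inner ℝ
    (contDiff_gradient hreg.sol_contDiff (by norm_num))

theorem contDiff_laplacian (hM : M.IsRegular) : ContDiff ℝ 2 (Δ ψ) := by
  rw [funext hreg.laplacian_eq]
  exact ((contDiff_const.mul hreg.test_contDiff).sub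
    (hreg.contDiff_inner_gradient hM)).sub contDiff_const

-- The Poisson equation bounds two derivatives of `Δ ψ`, although `ψ` has only three of them.
theorem norm_fderiv_fderiv_laplacian_le (hM : M.IsRegular) (θ : Param d) :
    ‖fderiv ℝ (fderiv ℝ (Δ ψ)) θ‖ ≤ 2 * ‖iteratedFDeriv ℝ 2 φ θ‖
      + (‖iteratedFDeriv ℝ 1 (fun θ' => Real.log (M.posterior θ')) θ‖ * ‖iteratedFDeriv ℝ 3 ψ θ‖
        + 2 * ‖iteratedFDeriv ℝ 2 (fun θ' => Real.log (M.posterior θ')) θ‖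
          * ‖iteratedFDeriv ℝ 2 ψ θ‖
        + ‖iteratedFDeriv ℝ 3 (fun θ' => Real.log (M.posterior θ')) θ‖
          * ‖iteratedFDeriv ℝ 1 ψ θ‖) := by
  set ℓ : Param d → ℝ := fun θ => inner ℝ (∇ (fun θ' => Real.log (M.posterior θ')) θ) (∇ ψ θ)
  have hℓ : ContDiff ℝ 2 ℓ := hreg.contDiff_inner_gradient hM
  have h_test : ContDiff ℝ 2 ((2 : ℝ) • φ) := contDiff_const.smul hreg.test_contDiff
  have h_diff : ContDiff ℝ 2 ((2 : ℝ) • φ - ℓ) := h_test.sub hℓ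
  have h_eq : Δ ψ = (2 : ℝ) • φ - ℓ - fun _ => 2 * M.posteriorMean φ := funext hreg.laplacian_eq
  rw [norm_fderiv_fderiv, h_eq, iteratedFDeriv_sub_apply h_diff.contDiffAt contDiffAt_const,
    iteratedFDeriv_sub_apply h_test.contDiffAt hℓ.contDiffAt,
    iteratedFDeriv_const_of_ne two_ne_zero, Pi.zero_apply, sub_zero,
    iteratedFDeriv_const_smul_apply hreg.test_contDiff.contDiffAt]
  refine (norm_sub_le _ _).trans (add_le_add ?_ ?_)
  · rw [norm_smul, Real.norm_two]
  · exact norm_iteratedFDeriv_two_inner_gradient_le hM.contDiff_log_posterior hreg.sol_contDiff θ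

theorem isBigO_sol {k : ℕ} (hk : k < 4) {t : ℝ} (ht : max (⨆ k, p k) r ≤ t) :
    iteratedFDeriv ℝ k ψ =O[⊤] fun θ => (1 + Γ θ) ^ t := by
  obtain ⟨C, hC⟩ := hreg.sol_growth ⟨k, hk⟩
  have hp : p ⟨k, hk⟩ ≤ t :=
    (le_ciSup (Finite.bddAbove_range p) ⟨k, hk⟩).trans ((le_max_left _ _).trans ht)
  refine (isBigO_of_le' (c := C) _ fun θ => ?_).trans
    (isBigO_rpow_one_add_rpow hreg.dom_nonneg (hreg.p_pos ⟨k, hk⟩).le hp)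
  rw [Real.norm_of_nonneg (Real.rpow_nonneg (hreg.dom_nonneg θ) _)]
  exact hC θ

theorem isBigO_test {t : ℝ} (ht : max (⨆ k, p k) r ≤ t) :
    iteratedFDeriv ℝ 2 φ =O[⊤] fun θ => (1 + Γ θ) ^ t := by
  obtain ⟨C, hC⟩ := hreg.test_growth
  refine (isBigO_of_le' (c := C) _ fun θ => ?_).trans
    (isBigO_one_add_rpow_one_add_rpow hreg.dom_nonneg hreg.r_pos.le ((le_max_right _ _).trans ht))
  rw [Real.norm_of_nonneg (add_nonneg zero_le_one (Real.rpow_nonneg (hreg.dom_nonneg θ) _))]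
  exact hC θ

theorem isBigO_logPosterior {k : ℕ} (hk : 1 ≤ k) (hk' : k ≤ 3) :
    iteratedFDeriv ℝ k (fun θ => Real.log (M.posterior θ)) =O[⊤] fun θ => (1 + Γ θ) ^ q := by
  obtain ⟨C, hC⟩ := hreg.logPosterior_growth k hk hk'
  refine (isBigO_of_le' (c := C) _ fun θ => ?_).trans
    (isBigO_one_add_rpow_one_add_rpow hreg.dom_nonneg hreg.q_pos.le le_rfl)
  rw [Real.norm_of_nonneg (add_nonneg zero_le_one (Real.rpow_nonneg (hreg.dom_nonneg θ) _))]
  exact hC θ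

theorem isBigO_fderiv_fderiv_laplacian (hM : M.IsRegular) :
    fderiv ℝ (fderiv ℝ (Δ ψ)) =O[⊤] fun θ => (1 + Γ θ) ^ (max (⨆ k, p k) r + q) := by
  have h_test : (fun θ => 2 * ‖iteratedFDeriv ℝ 2 φ θ‖) =O[⊤]
      fun θ => (1 + Γ θ) ^ (max (⨆ k, p k) r + q) :=
    (hreg.isBigO_test (le_add_of_nonneg_right hreg.q_pos.le)).norm_left.const_mul_left 2
  have h_mul : ∀ {k l : ℕ}, 1 ≤ k → k ≤ 3 → l < 4 →
      (fun θ => ‖iteratedFDeriv ℝ k (fun θ => Real.log (M.posterior θ)) θ‖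
        * ‖iteratedFDeriv ℝ l ψ θ‖) =O[⊤] fun θ => (1 + Γ θ) ^ (max (⨆ k, p k) r + q) := by
    intro k l hk hk' hl
    refine ((hreg.isBigO_logPosterior hk hk').norm_left.mul
      (hreg.isBigO_sol hl le_rfl).norm_left).congr_right fun θ => ?_
    rw [mul_comm, Real.rpow_add (add_pos_of_pos_of_nonneg one_pos (hreg.dom_nonneg θ))]
  refine (isBigO_of_le _ fun θ => ?_).trans (h_test.add (((h_mul le_rfl (by norm_num)
    (by norm_num : 3 < 4)).add ((h_mul (by norm_num : 1 ≤ 2) (by norm_num)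
    (by norm_num : 2 < 4)).const_mul_left 2)).add (h_mul (by norm_num : 1 ≤ 3) le_rfl
    (by norm_num : 1 < 4))))
  refine (hreg.norm_fderiv_fderiv_laplacian_le hM θ).trans ((le_of_eq ?_).trans (le_abs_self _))
  ring

theorem isBigO_laplacian {t : ℝ} (ht : max (⨆ k, p k) r ≤ t) :
    Δ ψ =O[⊤] fun θ => (1 + Γ θ) ^ t :=
  (isBigO_of_le' _ fun θ => (abs_laplacian_le ψ θ).trans_eq (by rw [norm_norm])).trans
    (hreg.isBigO_sol (k := 2) (by norm_num) ht).norm_left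

theorem isBigO_fderiv_laplacian {t : ℝ} (ht : max (⨆ k, p k) r ≤ t) :
    fderiv ℝ (Δ ψ) =O[⊤] fun θ => (1 + Γ θ) ^ t :=
  (isBigO_of_le' _ fun θ => (norm_fderiv_laplacian_le hreg.sol_contDiff θ).trans_eq
    (by rw [norm_norm])).trans (hreg.isBigO_sol (k := 3) (by norm_num) ht).norm_left

theorem isBigO_drift {β : Type*} {v : β → Param d → Param d} {c : ℝ}
    (hc : ∀ b θ, ‖v b θ‖ ≤ c * (1 + Γ θ ^ q)) :
    (fun x : β × Param d => v x.1 x.2) =O[⊤] fun x => (1 + Γ x.2) ^ q := by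
  refine (isBigO_of_le' (c := c) _ fun x => ?_).trans (isBigO_one_add_rpow_one_add_rpow
    (fun x : β × Param d => hreg.dom_nonneg x.2) hreg.q_pos.le le_rfl)
  rw [Real.norm_of_nonneg (add_nonneg zero_le_one (Real.rpow_nonneg (hreg.dom_nonneg x.2) q))]
  exact hc x.1 x.2

theorem exists_growthBounds (hM : M.IsRegular) {β : Type*} {v : β → Param d → Param d}
    (hv : ∀ b, Continuous (v b)) {c : ℝ} (hc : ∀ b θ, ‖v b θ‖ ≤ c * (1 + Γ θ ^ q)) :
    ∃ A κ : ℝ, GrowthBounds (fun θ => 1 + Γ θ) ψ v A κ (max (⨆ k, p k) r + q) q := by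
  have hΓ := hreg.dom_nonneg
  have hW : ∀ θ (t : ℝ), 0 ≤ (1 + Γ θ) ^ t := fun θ t => Real.rpow_nonneg (by linarith [hΓ θ]) t
  have ht : max (⨆ k, p k) r ≤ max (⨆ k, p k) r + q := le_add_of_nonneg_right hreg.q_pos.le
  obtain ⟨A, hA, hA_sol, hA_lap, hA_fderiv, hA_fderiv₂, hA_drift⟩ :=
    ((eventually_ge_atTop 1).and <| (eventually_all.2 fun k : Fin 3 =>
        eventually_norm_le_mul_of_isBigO (hW · _) (hreg.isBigO_sol (k := k) (by lia) ht)).and <|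
      (eventually_norm_le_mul_of_isBigO (hW · _) (hreg.isBigO_laplacian ht)).and <|
      (eventually_norm_le_mul_of_isBigO (hW · _) (hreg.isBigO_fderiv_laplacian ht)).and <|
      (eventually_norm_le_mul_of_isBigO (hW · _) (hreg.isBigO_fderiv_fderiv_laplacian hM)).and <|
      eventually_norm_le_mul_of_isBigO (fun x : β × Param d => hW x.2 _)
        (hreg.isBigO_drift hc)).exists
  obtain ⟨C, hC⟩ := hreg.dom_segment _ hreg.momentOrder_pos le_rfl
  exact ⟨A, _, {
    one_le_A := hA
    one_le_κ := le_add_of_nonneg_right (by positivity)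
    a_pos := add_pos (lt_max_of_lt_right hreg.r_pos) hreg.q_pos
    q_pos := hreg.q_pos
    measurable := hreg.dom_measurable.const_add 1
    one_le := fun θ => le_add_of_nonneg_right (hΓ θ)
    segment := fun θ u _ => one_add_le_mul_max_of_segment hΓ hreg.momentOrder_pos hC θ u
    contDiff := hreg.sol_contDiff.of_le (by norm_num)
    contDiff_laplacian := hreg.contDiff_laplacian hM
    abs_sol_le := by simpa using hA_sol 0
    norm_fderiv_le := by simpa [norm_iteratedFDeriv_one] using hA_sol 1
    norm_fderiv_fderiv_le := by simpa [norm_fderiv_fderiv] using hA_sol 2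
    abs_laplacian_le := hA_lap
    norm_fderiv_laplacian_le := hA_fderiv
    norm_fderiv_fderiv_laplacian_le := hA_fderiv₂
    continuous_drift := hv
    norm_drift_le := fun b θ => hA_drift (b, θ) }⟩

theorem sub_posteriorMean_eq_driftGenerator (θ : Param d) :
    φ θ - M.posteriorMean φ
      = driftGenerator (∇ fun θ' => Real.log (M.posterior θ')) ψ θ := by
  rw [← hreg.poisson θ, Model.generator, driftGenerator, real_inner_comm, inner_gradient_left]
  ring

theorem exists_norm_estimator_le {β : Type*} [Finite β] {v : β → Param d → Param d}
    (hv : ∀ b, ∃ c, ∀ θ, ‖v b θ - ∇ (fun θ' => Real.log (M.posterior θ')) θ‖ ≤ c) :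
    ∃ c, ∀ b θ, ‖v b θ‖ ≤ c * (1 + Γ θ ^ q) := by
  choose c hc using hv
  obtain ⟨c₀, hc₀⟩ := Finite.exists_le c
  obtain ⟨c₁, hc₁⟩ := hreg.logPosterior_growth 1 le_rfl (by norm_num)
  refine ⟨|c₀| + c₁, fun b θ => (norm_le_norm_sub_add _
    (∇ (fun θ' => Real.log (M.posterior θ')) θ)).trans ?_⟩
  rw [add_mul]
  refine add_le_add (((hc b θ).trans ((hc₀ b).trans (le_abs_self c₀))).trans ?_) ?_
  · exact le_mul_of_one_le_right (abs_nonneg _)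
      (le_add_of_nonneg_right (Real.rpow_nonneg (hreg.dom_nonneg θ) q))
  · rw [← norm_iteratedFDeriv_zero (𝕜 := ℝ), norm_iteratedFDeriv_gradient]
    exact hc₁ θ

end PoissonRegularity

end PoissonRegularity

section MeanSquareError

variable {d S : ℕ} {𝒳 : Type*} {M : Model d S 𝒳} {φ ψ Γ : Param d → ℝ} {p : Fin 4 → ℝ} {r q : ℝ}
  {Ω : Type*} {θ₀ : Ω → Param d} {Z : ℕ → Ω → Param d} {β : Type*} {w : β → ℝ} {B : ℕ → Ω → β}
  {v : β → Param d → Param d} {H : Set ℝ}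

theorem sampleAverage_sub_const (φ : Param d → ℝ) (c : ℝ) (θ : ℕ → Ω → Param d) {T : ℕ}
    (hT : 0 < T) (ω : Ω) :
    sampleAverage (fun θ => φ θ - c) θ T ω = sampleAverage φ θ T ω - c := by
  simp only [sampleAverage, Finset.sum_sub_distrib, Finset.sum_const, Nat.card_Icc,
    add_tsub_cancel_right, nsmul_eq_mul, mul_sub]
  rw [inv_mul_cancel_left₀ (Nat.cast_ne_zero.2 hT.ne')]

variable [MeasurableSpace Ω] {P : Measure Ω}

/-- The mean squared errors of the sample averages of `φ` along the chains `θ h`, as estimators of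
`c`, are finite and bounded by `bound h T` up to a factor that depends on neither the step size
`h ∈ H` nor the number `T` of steps. -/
def HasMeanSquareErrorBound (P : Measure Ω) (φ : Param d → ℝ) (θ : ℝ → ℕ → Ω → Param d) (c : ℝ)
    (H : Set ℝ) (bound : ℝ → ℕ → ℝ) : Prop :=
  ∃ C : ℝ, 0 < C ∧ ∀ h ∈ H, ∀ T : ℕ, 0 < T →
    Integrable (fun ω => (sampleAverage φ (θ h) T ω - c) ^ 2) P ∧
    ∫ ω, (sampleAverage φ (θ h) T ω - c) ^ 2 ∂P ≤ C * bound h T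

theorem HasMeanSquareErrorBound.mono {θ : ℝ → ℕ → Ω → Param d} {c : ℝ} {bound bound' : ℝ → ℕ → ℝ}
    (hθ : HasMeanSquareErrorBound P φ θ c H bound) (h_le : ∀ h T, bound h T ≤ bound' h T) :
    HasMeanSquareErrorBound P φ θ c H bound' := by
  obtain ⟨C, hC, h_bound⟩ := hθ
  exact ⟨C, hC, fun h hh T hT => ⟨(h_bound h hh T hT).1,
    (h_bound h hh T hT).2.trans (mul_le_mul_of_nonneg_left (h_le h T) hC.le)⟩⟩

variable [IsProbabilityMeasure P] [Countable β] [MeasurableSpace β] [MeasurableSingletonClass β]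

theorem GrowthBounds.hasMeanSquareErrorBound {W : Param d → ℝ} {A κ a c K : ℝ}
    (hW : GrowthBounds W ψ v A κ a q) (hN : IsDrivingNoise P w θ₀ B Z) (hH : ∀ h ∈ H, 0 < h)
    (hK : ∀ h ∈ H, ∀ t, Integrable (fun ω => W (chain v θ₀ B Z h t ω) ^ (2 * a + 4 * q)) P ∧
      ∫ ω, W (chain v θ₀ B Z h t ω) ^ (2 * a + 4 * q) ∂P ≤ K)
    (hφ : ∀ θ, φ θ - c = driftGenerator (fun θ => ∫ b, v b θ ∂(P.map (B 0))) ψ θ) :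
    HasMeanSquareErrorBound P φ (chain v θ₀ B Z) c H fun h T => 1 / (h * T) + h ^ 2 := by
  obtain ⟨C, hC, h_bound⟩ := hW.exists_secondMomentLE_sampleAverage hN hH hK
  refine ⟨C, hC, fun h hh T hT => ?_⟩
  have h_moment := h_bound h hh T hT
  rw [← funext hφ, funext (sampleAverage_sub_const φ c _ hT)] at h_moment
  exact ⟨h_moment.1.integrable_sq, h_moment.2⟩

theorem Model.IsUnbiasedEstimator.integral_eq (hv : M.IsUnbiasedEstimator w v)
    (hN : IsDrivingNoise P w θ₀ B Z) {θ : Param d} {C : ℝ} (hC : ∀ b, ‖v b θ‖ ≤ C) :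
    ∫ b, v b θ ∂(P.map (B 0)) = ∇ (fun θ' => Real.log (M.posterior θ')) θ := by
  have := Measure.isProbabilityMeasure_map (μ := P) (hN.measurable_batch 0).aemeasurable
  rw [integral_countable (.of_bound Measurable.of_discrete.aestronglyMeasurable C (ae_of_all _ hC))]
  simp_rw [map_measureReal_apply (hN.measurable_batch 0) (measurableSet_singleton _), hN.batch_law]
  exact (hv.hasSum θ).tsum_eq

end MeanSquareError

end DSGLD

end

theorem theorem1_general {d S : ℕ} {𝒳 : Type*} {M : DSGLD.Model d S 𝒳} (hM : M.IsRegular)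
    {φ ψ Γ : DSGLD.Param d → ℝ} {p : Fin 4 → ℝ} {r q : ℝ}
    (hreg : DSGLD.PoissonRegularity M φ ψ Γ p r q) {H : Set ℝ} (hH : ∀ h ∈ H, 0 < h)
    {Ω : Type*} [MeasurableSpace Ω] {P : Measure Ω} [IsProbabilityMeasure P]
    {θ₀ : Ω → DSGLD.Param d} {Z : ℕ → Ω → DSGLD.Param d} {β : Type*} [Countable β]
    [MeasurableSpace β] [MeasurableSingletonClass β] {w : β → ℝ} {B : ℕ → Ω → β}
    {v : β → DSGLD.Param d → DSGLD.Param d} (hN : DSGLD.IsDrivingNoise P w θ₀ B Z)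
    (hmom : DSGLD.MomentsBounded P Γ (DSGLD.momentOrder p r q) H (DSGLD.chain v θ₀ B Z))
    (hv : M.IsUnbiasedEstimator w v) {c : ℝ} (hc : ∀ b θ, ‖v b θ‖ ≤ c * (1 + Γ θ ^ q)) :
    DSGLD.HasMeanSquareErrorBound P φ (DSGLD.chain v θ₀ B Z) (M.posteriorMean φ) H
      fun h T => 1 / (h * T) + h ^ 2 := by
  obtain ⟨A, κ, hW⟩ := hreg.exists_growthBounds hM hv.continuous hc
  obtain ⟨K, hK⟩ := hmom _ hreg.momentOrder_pos le_rfl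
  have h_order : 2 * (max (⨆ k, p k) r + q) + 4 * q = DSGLD.momentOrder p r q := by
    unfold DSGLD.momentOrder
    ring
  refine hW.hasMeanSquareErrorBound (K := 2 ^ DSGLD.momentOrder p r q * (1 + K)) hN hH
    (fun h hh t => ?_) fun θ => ?_
  · rw [h_order]
    exact DSGLD.integrable_one_add_rpow (hreg.dom_measurable.comp
      ((hN.isDrivenBy_chain hv.continuous h).measurable_state t)) (fun ω => hreg.dom_nonneg _)
      hreg.momentOrder_pos.le (hK h hh t).1 (hK h hh t).2
  · rw [funext fun θ => hv.integral_eq hN (hc · θ)]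
    exact hreg.sub_posteriorMean_eq_driftGenerator θ

theorem theorem1 {d S : ℕ} {𝒳 : Type*} (M : DSGLD.Model d S 𝒳) (hM : M.IsRegular)
    (f : Fin S → ℝ) (hf_pos : ∀ s, 0 < f s) (hf_sum : ∑ s, f s = 1)
    (m : ℕ) (hm : 0 < m)
    (γ : Fin S → ℝ) (hγ : ∀ s i θ, ‖M.gradLogLik (M.x s i) θ‖ ≤ γ s)
    (φ ψ Γ : DSGLD.Param d → ℝ) (p : Fin 4 → ℝ) (r q : ℝ)
    (hreg : DSGLD.PoissonRegularity M φ ψ Γ p r q)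
    (H : Set ℝ) (hH : ∀ h ∈ H, 0 < h)
    {Ω : Type*} [MeasurableSpace Ω] (P : MeasureTheory.Measure Ω)
    [MeasureTheory.IsProbabilityMeasure P]
    (θ₀ : Ω → DSGLD.Param d) (Z : ℕ → Ω → DSGLD.Param d) :
    -- the bound for DSGLD
    (∀ B : ℕ → Ω → M.ShardBatch m,
      DSGLD.IsDrivingNoise P (M.shardBatchProb f m) θ₀ B Z →
      DSGLD.MomentsBounded P Γ (DSGLD.momentOrder p r q) H
        (DSGLD.chain (M.dsgldEstimator f m) θ₀ B Z) →
      ∃ C : ℝ, 0 < C ∧ ∀ h ∈ H, ∀ T : ℕ, 0 < T →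
        MeasureTheory.Integrable (fun ω =>
          (DSGLD.sampleAverage φ (DSGLD.chain (M.dsgldEstimator f m) θ₀ B Z h) T ω
            - M.posteriorMean φ) ^ 2) P ∧
        ∫ ω, (DSGLD.sampleAverage φ (DSGLD.chain (M.dsgldEstimator f m) θ₀ B Z h) T ω
            - M.posteriorMean φ) ^ 2 ∂P
          ≤ C * ((∑ s, (M.N s : ℝ) ^ 2 / f s * γ s ^ 2) / (m * T) + 1 / (h * T) + h ^ 2)) ∧
    -- all shards merged into one: the bound for SGLD
    (∀ B : ℕ → Ω → M.MergedBatch m,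
      DSGLD.IsDrivingNoise P (M.mergedBatchProb m) θ₀ B Z →
      DSGLD.MomentsBounded P Γ (DSGLD.momentOrder p r q) H
        (DSGLD.chain (M.sgldEstimator m) θ₀ B Z) →
      ∀ γ' : ℝ, (∀ s, γ s ≤ γ') →
      ∃ C : ℝ, 0 < C ∧ ∀ h ∈ H, ∀ T : ℕ, 0 < T →
        MeasureTheory.Integrable (fun ω =>
          (DSGLD.sampleAverage φ (DSGLD.chain (M.sgldEstimator m) θ₀ B Z h) T ω
            - M.posteriorMean φ) ^ 2) P ∧
        ∫ ω, (DSGLD.sampleAverage φ (DSGLD.chain (M.sgldEstimator m) θ₀ B Z h) T ω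
            - M.posteriorMean φ) ^ 2 ∂P
          ≤ C * ((M.total : ℝ) ^ 2 * γ' ^ 2 / (m * T) + 1 / (h * T) + h ^ 2)) := by
  constructor
  · intro B hN hmom
    obtain ⟨c, hc⟩ := hreg.exists_norm_estimator_le (v := M.dsgldEstimator f m) fun b => ⟨_,
      hM.norm_estimator_sub_grad_log_posterior_le hγ (M.N b.1 / (f b.1 * m))
        fun j => ⟨b.1, b.2 j⟩⟩
    refine (theorem1_general hM hreg hH hN hmom
      (hM.isUnbiasedEstimator_dsgldEstimator hf_pos hf_sum hm) hc).mono fun h T => ?_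
    have h_var : 0 ≤ ∑ s, (M.N s : ℝ) ^ 2 / f s * γ s ^ 2 := Finset.sum_nonneg fun s _ =>
      mul_nonneg (div_nonneg (sq_nonneg _) (hf_pos s).le) (sq_nonneg _)
    rw [add_assoc]
    exact le_add_of_nonneg_left (by positivity)
  · intro B hN hmom γ' _
    have hS : 0 < S := Nat.pos_of_ne_zero fun hS => by subst hS; simp at hf_sum
    obtain ⟨c, hc⟩ := hreg.exists_norm_estimator_le (v := M.sgldEstimator m) fun b => ⟨_,
      hM.norm_estimator_sub_grad_log_posterior_le hγ (M.total / m) b⟩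
    refine (theorem1_general hM hreg hH hN hmom
      (hM.isUnbiasedEstimator_sgldEstimator hS hm) hc).mono fun h T => ?_
    rw [add_assoc]
    exact le_add_of_nonneg_left (by positivity)
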